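/- We identify partitions that differ only by trailing zeros, call the positive entries of a partition its parts, write $l(\lambda)$ for the number of parts of $\lambda$, and identify $\lambda$ with its diagram (with $\lambda_i$ left-justified boxes in row $i$). For $\mu\subseteq\lambda$ the skew diagram $\lambda/\mu$ is the set of boxes of $\lambda$ not in $\mu$; it is called basic if $\mu_i<\lambda_i$ and $\mu_i\le\lambda_{i+1}$ for all $1\le i\le l(\lambda)$, i.e. if it has no empty rows or columns. If $\lambda/\mu$ has $n$ boxes, its skew character is the character $[\lambda/\mu]=\sum_{\nu\vdash n}c(\lambda;\mu,\nu)[\nu]$ of the symmetric group $S_n$, where $[\nu]$ is the irreducible character labelled by $\nu$ and $c(\lambda;\mu,\nu)$ is the Littlewood–Richardson coefficient, i.e. the number of semistandard tableaux of shape $\lambda/\mu$ and content $\nu$ whose reverse row word is a lattice word. **Theorem 3.5.** Let $\lambda/\mu$ and $\alpha/\beta$ be basic skew diagrams, where $\mu$ is a nonempty rectangle, i.e. $\mu=(c^m)$ with $c,m\ge 1$, and $\beta$ is a rectangle, possibly empty. Suppose that $[\lambda/\mu]=[\alpha/\beta]$ (in particular, $\lambda/\mu$ and $\alpha/\beta$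 have the same number of boxes) and that $\lambda$ has exactly two different parts. Then $\alpha$ also has exactly two different parts, and $\alpha/\beta$ equals $\lambda/\mu$ or (up to translation) the rotation $(\lambda/\mu)^\circ$ of $\lambda/\mu$ by $180^\circ$. -/

import Mathlib

/-!
Partitions are Mathlib's `YoungDiagram`s: finite lower sets of boxes `(i, j) : ℕ × ℕ`, where `i` is
the row and `j` the column, both counted from `0`. So `lam.rowLen i` is the `(i+1)`-st entry of the
partition `lam` (zero beyond the last part), `lam.rowLens` is the list of its positive parts and
`lam.colLen 0` is its length. -/

namespace SkewChar

/-- The number of different (positive) parts of a partition. -/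
def dp (lam : YoungDiagram) : ℕ := lam.rowLens.toFinset.card

/-- The partition is a rectangle `(c^m)`; the empty rectangle is included. -/
def IsRectangle (mu : YoungDiagram) : Prop :=
  ∃ m c : ℕ, mu.cells = Finset.range m ×ˢ Finset.range c

/-- The skew diagram `lam / mu`, as a set of boxes. -/
def skewDiagram (lam mu : YoungDiagram) : Finset (ℕ × ℕ) := lam.cells \ mu.cells

/-- `lam / mu` is a basic skew diagram: `mu ⊆ lam`, and `mu_i < lam_i`, `mu_i ≤ lam_{i+1}` for every
row index `i` up to the length of `lam` (equivalently, `lam / mu` has no empty row or column). -/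
def IsBasic (lam mu : YoungDiagram) : Prop :=
  mu ≤ lam ∧
    ∀ i < lam.colLen 0, mu.rowLen i < lam.rowLen i ∧ mu.rowLen i ≤ lam.rowLen (i + 1)

/-- `E` is, up to translation, the rotation of `D` by 180 degrees: for some `p`, `q` the point
reflection `(i, j) ↦ (p - i, q - j)` carries `D` onto `E`. -/
def IsRotation (D E : Finset (ℕ × ℕ)) : Prop :=
  ∃ p q : ℕ, ∀ i j : ℕ, (i, j) ∈ E ↔ ∃ x ∈ D, x.1 + i = p ∧ x.2 + j = q

/-- The reverse row word of a filling `T` of `lam / mu`: the rows are read from top to bottom, each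
of them from right to left. -/
def reverseRowWord (lam mu : YoungDiagram) (T : ℕ → ℕ → ℕ) : List ℕ :=
  (List.range (lam.colLen 0)).flatMap fun i =>
    (((List.range (lam.rowLen i)).filter fun j => mu.rowLen i ≤ j).reverse).map (T i)

/-- Lattice words: in every initial segment, and for every `k ≥ 1`, the letter `k` occurs at least
as often as the letter `k + 1`. -/
def IsLatticeWord (w : List ℕ) : Prop :=
  ∀ n k : ℕ, 1 ≤ k → (w.take n).count (k + 1) ≤ (w.take n).count k

/-- Littlewood–Richardson tableaux of shape `lam / mu` and content `nu`: semistandard fillings of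
the boxes of `lam / mu` with positive integers such that the entry `k + 1` occurs `nu.rowLen k`
times and the reverse row word is a lattice word. Positions outside `lam / mu` carry the dummy
value `0`, so that a tableau is determined by its entries in the boxes. -/
structure LRTableau (lam mu nu : YoungDiagram) where
  entry : ℕ → ℕ → ℕ
  pos : ∀ i j, (i, j) ∈ skewDiagram lam mu → 0 < entry i j
  zero : ∀ i j, (i, j) ∉ skewDiagram lam mu → entry i j = 0
  row_weak : ∀ i j, (i, j) ∈ skewDiagram lam mu → (i, j + 1) ∈ skewDiagram lam mu →
    entry i j ≤ entry i (j + 1)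
  col_strict : ∀ i j, (i, j) ∈ skewDiagram lam mu → (i + 1, j) ∈ skewDiagram lam mu →
    entry i j < entry (i + 1) j
  content : ∀ k, ((skewDiagram lam mu).filter fun x => entry x.1 x.2 = k + 1).card = nu.rowLen k
  lattice : IsLatticeWord (reverseRowWord lam mu entry)

/-- The Littlewood–Richardson coefficient `c(lam; mu, nu)`. -/
noncomputable def lrCoeff (lam mu nu : YoungDiagram) : ℕ := Nat.card (LRTableau lam mu nu)

/-- The partitions of `n`. -/
abbrev PartitionOf (n : ℕ) : Type := {nu : YoungDiagram // nu.card = n}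

instance finite_partitionOf (n : ℕ) : Finite (PartitionOf n) := by
  have key : ∀ nu : PartitionOf n, nu.1.cells ⊆ Finset.range n ×ˢ Finset.range n := by
    rintro ⟨nu, hnu⟩ ⟨i, j⟩ hij
    have hr : nu.rowLen i ≤ n := by
      rw [YoungDiagram.rowLen_eq_card, ← hnu]
      exact Finset.card_le_card (Finset.filter_subset _ _)
    have hc : nu.colLen j ≤ n := by
      rw [YoungDiagram.colLen_eq_card, ← hnu]
      exact Finset.card_le_card (Finset.filter_subset _ _)
    have h1 := YoungDiagram.mem_iff_lt_rowLen.1 (YoungDiagram.mem_cells _ |>.1 hij)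
    have h2 := YoungDiagram.mem_iff_lt_colLen.1 (YoungDiagram.mem_cells _ |>.1 hij)
    simp only [Finset.mem_product, Finset.mem_range]
    exact ⟨h2.trans_le hc, h1.trans_le hr⟩
  refine Finite.of_injective
    (fun nu : PartitionOf n =>
      (⟨nu.1.cells, Finset.mem_powerset.2 (key nu)⟩ :
        (Finset.range n ×ˢ Finset.range n).powerset)) ?_
  intro a b hab
  apply Subtype.ext
  apply YoungDiagram.ext
  exact congrArg Subtype.val hab

noncomputable instance fintype_partitionOf (n : ℕ) : Fintype (PartitionOf n) := Fintype.ofFinite _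

/-- The permutations `g` of the labels that preserve every row of the numbering `e` of the boxes
of `nu`. -/
def rowGroup {n : ℕ} {nu : YoungDiagram} (e : Fin n ≃ nu.cells) : Set (Equiv.Perm (Fin n)) :=
  {g | ∀ k, (e (g k)).1.1 = (e k).1.1}

/-- The permutations `g` of the labels that preserve every column of the numbering `e` of the boxes
of `nu`. -/
def colGroup {n : ℕ} {nu : YoungDiagram} (e : Fin n ≃ nu.cells) : Set (Equiv.Perm (Fin n)) :=
  {g | ∀ k, (e (g k)).1.2 = (e k).1.2}

open scoped Classical in
/-- The Young symmetrizer in `ℂ[S_n]` of a numbering `e` of the boxes of `nu`: the sum over the row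
group times the signed sum over the column group. -/
noncomputable def youngSymmetrizer {n : ℕ} {nu : YoungDiagram} (e : Fin n ≃ nu.cells) :
    MonoidAlgebra ℂ (Equiv.Perm (Fin n)) :=
  (∑ g : Equiv.Perm (Fin n) with g ∈ rowGroup e, MonoidAlgebra.single g (1 : ℂ)) *
    ∑ g : Equiv.Perm (Fin n) with g ∈ colGroup e,
      MonoidAlgebra.single g (((Equiv.Perm.sign g : ℤ) : ℂ))

/-- The Specht module of a numbering `e` of the boxes of `nu`: the left ideal of `ℂ[S_n]` generated
by the Young symmetrizer, with `S_n` acting by left multiplication. -/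
noncomputable def spechtRep {n : ℕ} {nu : YoungDiagram} (e : Fin n ≃ nu.cells) :
    Representation ℂ (Equiv.Perm (Fin n))
      (Ideal.span {youngSymmetrizer e} : Ideal (MonoidAlgebra ℂ (Equiv.Perm (Fin n)))) :=
  Representation.ofModule' _

/-- The irreducible character `[nu]` of `S_n` labelled by a partition `nu` of `n`: the character of
the Specht module of `nu` (any two numberings of the boxes give isomorphic modules, so an arbitrary
one is taken). -/
noncomputable def irrChar {n : ℕ} (nu : PartitionOf n) : Equiv.Perm (Fin n) → ℂ :=
  (spechtRep (Finset.equivFinOfCardEq nu.2).symm).character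

/-- The skew character `[lam / mu] = ∑ c(lam; mu, nu) [nu]` of `S_n`, where `n` is the number of
boxes of `lam / mu`. -/
noncomputable def skewChar (n : ℕ) (lam mu : YoungDiagram) : Equiv.Perm (Fin n) → ℂ :=
  ∑ nu : PartitionOf n, lrCoeff lam mu nu.1 • irrChar nu

end SkewChar

/-! Irreducible characters of S_n are linearly independent, so equal skew characters have equal
Littlewood–Richardson coefficients. Only a weaker consequence is used: the same contents occur among
the Littlewood–Richardson fillings of both diagrams (`exists_filling_of_skewChar_eq`). Independence
follows from triangularity: the row group of mu has nonzero invariants in the Specht module of nu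
only if nu dominates mu, and it does have some when nu = mu.

The contents of all fillings of a shape obey inequalities in its row and column lengths, and three
explicit fillings are tested against the inequalities of the other shape. `colFill` has the largest
content in dominance order, so the multiset of column lengths is an invariant
(`ContentsSubset.card_cols_eq`). `rowFill` has the sorted row lengths as content and controls the
number of long rows. `bumpFill` changes one entry v of `colFill` into v + 1; it exists when two
columns of length v start at different heights.

The diagram lam / mu is an L × a rectangle without an m × c rectangle at the upper left and a q × e
rectangle at the lower right. Then al has L rows and a columns too, and be is a nonempty k × d
rectangle with k = m or k = q. If m ≠ q, the lengths L - m and L - q cannot occur both below and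
beside be, since the content of `bumpFill` would violate an inequality that is tight for lam / mu
(`IsTwoRect.length_ne_of_eq`); this fixes d and all columns of al. If m = q, the columns only show
that the widths of the two removed rectangles add up to c + e, and `rowFill` shows that their
minimum is min c e (`IsTwoRect.min_le`). So the two corners agree or are interchanged, and
interchanging them is the rotation. -/

namespace SkewChar

open Finset

/-! ### Dominance order on partitions -/

/-- The number of boxes in the first `k` rows. -/
def boxesAbove (nu : YoungDiagram) (k : ℕ) : ℕ := (nu.cells.filter fun x => x.1 < k).card

theorem boxesAbove_succ (nu : YoungDiagram) (k : ℕ) :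
    boxesAbove nu (k + 1) = boxesAbove nu k + nu.rowLen k := by
  rw [boxesAbove, boxesAbove, YoungDiagram.rowLen_eq_card, YoungDiagram.row,
    ← card_union_of_disjoint]
  · congr 1
    ext x
    simp only [mem_filter, mem_union, YoungDiagram.mem_cells]
    grind
  · rw [disjoint_filter]
    intro x _ h
    omega

theorem youngDiagram_ext_rowLen {mu nu : YoungDiagram} (h : ∀ i, mu.rowLen i = nu.rowLen i) :
    mu = nu := by
  ext ⟨i, j⟩
  rw [YoungDiagram.mem_cells, YoungDiagram.mem_cells, YoungDiagram.mem_iff_lt_rowLen,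
    YoungDiagram.mem_iff_lt_rowLen, h]

theorem boxesAbove_injective : Function.Injective boxesAbove := by
  intro mu nu h
  refine youngDiagram_ext_rowLen fun i => ?_
  have h1 := boxesAbove_succ mu i
  have h2 := boxesAbove_succ nu i
  rw [h] at h1
  omega

/-- A column of nu of length l receives at most one box from each of the first k rows of mu, and at
most l boxes in all, hence at most min k l. Summed over the columns, these minima count the boxes in
the first k rows of nu. -/
theorem boxesAbove_le_of_rows_to_columns {mu nu : YoungDiagram} (f : mu.cells ≃ nu.cells)
    (hf : ∀ x y : mu.cells, x ≠ y → x.1.1 = y.1.1 → (f x).1.2 ≠ (f y).1.2) (k : ℕ) :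
    boxesAbove mu k ≤ boxesAbove nu k := by
  classical
  let S : Finset mu.cells := univ.filter fun x => x.1.1 < k
  have hS : boxesAbove mu k = S.card := by
    rw [boxesAbove, ← card_map (Function.Embedding.subtype (· ∈ mu.cells)) (s := S)]
    congr 1
    ext x
    simp [S]
    tauto
  rw [hS, boxesAbove]
  have h1 : ∀ x ∈ S, (f x).1.2 ∈ range (nu.rowLen 0) := by
    intro x _
    have h := (YoungDiagram.mem_cells _).1 (f x).2
    have h' := YoungDiagram.mem_iff_lt_rowLen.1 (show ((f x).1.1, (f x).1.2) ∈ nu from h)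
    exact mem_range.2 (h'.trans_le (nu.rowLen_anti _ _ (Nat.zero_le _)))
  have h2 : ∀ x ∈ nu.cells.filter (fun x => x.1 < k), x.2 ∈ range (nu.rowLen 0) := by
    intro x hx
    have h := (YoungDiagram.mem_cells _).1 (mem_filter.1 hx).1
    have h' := YoungDiagram.mem_iff_lt_rowLen.1 (show (x.1, x.2) ∈ nu from h)
    exact mem_range.2 (h'.trans_le (nu.rowLen_anti _ _ (Nat.zero_le _)))
  rw [card_eq_sum_card_fiberwise h1, card_eq_sum_card_fiberwise h2]
  refine sum_le_sum fun j _ => ?_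
  have h3 : (nu.cells.filter (fun x => x.1 < k)).filter (fun x => x.2 = j) =
      range (min k (nu.colLen j)) ×ˢ {j} := by
    ext ⟨a, b⟩
    simp only [mem_filter, YoungDiagram.mem_cells, mem_product, mem_range, mem_singleton,
      YoungDiagram.mem_iff_lt_colLen, lt_min_iff]
    constructor
    · rintro ⟨⟨h, h'⟩, rfl⟩; exact ⟨⟨h', h⟩, rfl⟩
    · rintro ⟨⟨h, h'⟩, rfl⟩; exact ⟨⟨h', h⟩, rfl⟩
  rw [h3, card_product, card_range, card_singleton, mul_one, le_min_iff]
  constructor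
  · refine (card_le_card_of_injOn (t := range k) (fun x => x.1.1) ?_ ?_).trans_eq (card_range k)
    · intro x hx
      simp [S] at hx
      simp [hx.1]
    · intro x hx y hy hxy
      simp [S] at hx hy
      by_contra hne
      exact hf x y hne hxy (hx.2.trans hy.2.symm)
  · refine (card_le_card_of_injOn (t := range (nu.colLen j)) (fun x => (f x).1.1) ?_ ?_).trans_eq
      (card_range _)
    · intro x hx
      simp [S] at hx
      have h := (YoungDiagram.mem_cells _).1 (f x).2
      have h' := YoungDiagram.mem_iff_lt_colLen.1 (show ((f x).1.1, (f x).1.2) ∈ nu from h)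
      rw [hx.2] at h'
      simpa using h'
    · intro x hx y hy hxy
      simp [S] at hx hy
      exact f.injective (Subtype.ext (Prod.ext hxy (hx.2.trans hy.2.symm)))

/-! ### Row and column sums in the group algebra -/

/-- The row group as a subgroup. -/
def rowSubgroup {n : ℕ} {nu : YoungDiagram} (e : Fin n ≃ nu.cells) :
    Subgroup (Equiv.Perm (Fin n)) where
  carrier := rowGroup e
  mul_mem' {a b} ha hb k := by rw [Equiv.Perm.mul_apply, ha, hb]
  one_mem' k := rfl
  inv_mem' {a} ha k := by rw [← ha]; simp

/-- The column group as a subgroup. -/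
def colSubgroup {n : ℕ} {nu : YoungDiagram} (e : Fin n ≃ nu.cells) :
    Subgroup (Equiv.Perm (Fin n)) where
  carrier := colGroup e
  mul_mem' {a b} ha hb k := by rw [Equiv.Perm.mul_apply, ha, hb]
  one_mem' k := rfl
  inv_mem' {a} ha k := by rw [← ha]; simp

open scoped Classical in
/-- The sum over the row group in the group algebra. -/
noncomputable def rowSum {n : ℕ} {nu : YoungDiagram} (e : Fin n ≃ nu.cells) :
    MonoidAlgebra ℂ (Equiv.Perm (Fin n)) :=
  ∑ g : Equiv.Perm (Fin n) with g ∈ rowGroup e, MonoidAlgebra.single g (1 : ℂ)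

open scoped Classical in
/-- The signed sum over the column group in the group algebra. -/
noncomputable def colSum {n : ℕ} {nu : YoungDiagram} (e : Fin n ≃ nu.cells) :
    MonoidAlgebra ℂ (Equiv.Perm (Fin n)) :=
  ∑ g : Equiv.Perm (Fin n) with g ∈ colGroup e,
    MonoidAlgebra.single g (((Equiv.Perm.sign g : ℤ) : ℂ))

theorem youngSymmetrizer_eq {n : ℕ} {nu : YoungDiagram} (e : Fin n ≃ nu.cells) :
    youngSymmetrizer e = rowSum e * colSum e := rfl

theorem single_mul_rowSum {n : ℕ} {nu : YoungDiagram} (e : Fin n ≃ nu.cells)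
    {g : Equiv.Perm (Fin n)} (hg : g ∈ rowGroup e) :
    MonoidAlgebra.single g (1 : ℂ) * rowSum e = rowSum e := by
  classical
  rw [rowSum, mul_sum]
  refine sum_bij' (fun x _ => g * x) (fun x _ => g⁻¹ * x) ?_ ?_ ?_ ?_ ?_
  · intro x hx
    exact mem_filter.2 ⟨mem_univ _, (rowSubgroup e).mul_mem hg (mem_filter.1 hx).2⟩
  · intro x hx
    exact mem_filter.2 ⟨mem_univ _,
      (rowSubgroup e).mul_mem ((rowSubgroup e).inv_mem hg) (mem_filter.1 hx).2⟩
  · intro x _; simp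
  · intro x _; simp
  · intro x _; simp [MonoidAlgebra.single_mul_single]

theorem rowSum_mul_single {n : ℕ} {nu : YoungDiagram} (e : Fin n ≃ nu.cells)
    {g : Equiv.Perm (Fin n)} (hg : g ∈ rowGroup e) :
    rowSum e * MonoidAlgebra.single g (1 : ℂ) = rowSum e := by
  classical
  rw [rowSum, sum_mul]
  refine sum_bij' (fun x _ => x * g) (fun x _ => x * g⁻¹) ?_ ?_ ?_ ?_ ?_
  · intro x hx
    exact mem_filter.2 ⟨mem_univ _, (rowSubgroup e).mul_mem (mem_filter.1 hx).2 hg⟩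
  · intro x hx
    exact mem_filter.2 ⟨mem_univ _,
      (rowSubgroup e).mul_mem (mem_filter.1 hx).2 ((rowSubgroup e).inv_mem hg)⟩
  · intro x _; simp
  · intro x _; simp
  · intro x _; simp [MonoidAlgebra.single_mul_single]

theorem single_mul_colSum {n : ℕ} {nu : YoungDiagram} (e : Fin n ≃ nu.cells)
    {g : Equiv.Perm (Fin n)} (hg : g ∈ colGroup e) :
    MonoidAlgebra.single g (1 : ℂ) * colSum e = ((Equiv.Perm.sign g : ℤ) : ℂ) • colSum e := by
  classical
  rw [colSum, mul_sum, smul_sum]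
  refine sum_bij' (fun x _ => g * x) (fun x _ => g⁻¹ * x) ?_ ?_ ?_ ?_ ?_
  · intro x hx
    exact mem_filter.2 ⟨mem_univ _, (colSubgroup e).mul_mem hg (mem_filter.1 hx).2⟩
  · intro x hx
    exact mem_filter.2 ⟨mem_univ _,
      (colSubgroup e).mul_mem ((colSubgroup e).inv_mem hg) (mem_filter.1 hx).2⟩
  · intro x _; simp
  · intro x _; simp
  · intro x _
    rw [MonoidAlgebra.single_mul_single, MonoidAlgebra.smul_single, one_mul, smul_eq_mul]
    congr 1
    have h : (Equiv.Perm.sign g : ℤ) * (Equiv.Perm.sign g : ℤ) = 1 :=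
      Int.isUnit_mul_self (Equiv.Perm.sign g).isUnit
    have h' : (((Equiv.Perm.sign g : ℤ) : ℂ)) * ((Equiv.Perm.sign g : ℤ) : ℂ) = 1 := by
      exact_mod_cast h
    rw [Equiv.Perm.sign_mul]
    push_cast
    rw [← mul_assoc, h', one_mul]

/-- Without dominance, for every g two labels share a row of `e` while their preimages under g share
a column of `e'`. The transposition of these labels is absorbed by the row sum and, moved past g,
changes the sign of the column sum, so the product equals its own negative. -/
theorem rowSum_mul_mul_colSum_eq_zero {n : ℕ} {mu nu : YoungDiagram} (e : Fin n ≃ mu.cells)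
    (e' : Fin n ≃ nu.cells) (h : ¬ boxesAbove mu ≤ boxesAbove nu)
    (z : MonoidAlgebra ℂ (Equiv.Perm (Fin n))) : rowSum e * z * colSum e' = 0 := by
  classical
  induction z using MonoidAlgebra.induction_linear with
  | zero => simp
  | add x y hx hy => rw [mul_add, add_mul, hx, hy, add_zero]
  | single g r =>
    have hex : ∃ k l : Fin n, k ≠ l ∧ (e k).1.1 = (e l).1.1 ∧
        (e' (g⁻¹ k)).1.2 = (e' (g⁻¹ l)).1.2 := by
      by_contra hcon
      push Not at hcon
      refine h fun k => boxesAbove_le_of_rows_to_columns ((e.symm.trans g⁻¹).trans e') ?_ k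
      intro x y hxy hrow
      have := hcon (e.symm x) (e.symm y) (fun h => hxy (e.symm.injective h)) (by simpa using hrow)
      simpa using this
    obtain ⟨k, l, hkl, hrow, hcol⟩ := hex
    have ht : Equiv.swap k l ∈ rowGroup e := by
      intro i
      rcases eq_or_ne i k with rfl | hik
      · rw [Equiv.swap_apply_left, hrow]
      rcases eq_or_ne i l with rfl | hil
      · rw [Equiv.swap_apply_right, hrow]
      rw [Equiv.swap_apply_of_ne_of_ne hik hil]
    have hs : Equiv.swap (g⁻¹ k) (g⁻¹ l) ∈ colGroup e' := by
      intro i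
      rcases eq_or_ne i (g⁻¹ k) with rfl | hik
      · rw [Equiv.swap_apply_left, hcol]
      rcases eq_or_ne i (g⁻¹ l) with rfl | hil
      · rw [Equiv.swap_apply_right, hcol]
      rw [Equiv.swap_apply_of_ne_of_ne hik hil]
    have hcomm : Equiv.swap k l * g = g * Equiv.swap (g⁻¹ k) (g⁻¹ l) := by
      have := Equiv.mul_swap_eq_swap_mul g (g⁻¹ k) (g⁻¹ l)
      simpa using this.symm
    have h1 : rowSum e * MonoidAlgebra.single g r =
        rowSum e * MonoidAlgebra.single g r *
          MonoidAlgebra.single (Equiv.swap (g⁻¹ k) (g⁻¹ l)) (1 : ℂ) := by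
      conv_lhs => rw [← rowSum_mul_single e ht]
      rw [mul_assoc, mul_assoc, MonoidAlgebra.single_mul_single, MonoidAlgebra.single_mul_single,
        hcomm, one_mul, mul_one]
    have h2 : rowSum e * MonoidAlgebra.single g r * colSum e' =
        -(rowSum e * MonoidAlgebra.single g r * colSum e') := by
      conv_lhs => rw [h1]
      rw [mul_assoc, single_mul_colSum e' hs, Equiv.Perm.sign_swap
        (fun h => hkl (g⁻¹.injective h))]
      simp
    have h3 : (2 : ℂ) • (rowSum e * MonoidAlgebra.single g r * colSum e') = 0 := by
      rw [two_smul]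
      nth_rewrite 1 [h2]
      rw [neg_add_cancel]
    exact (smul_eq_zero.1 h3).resolve_left two_ne_zero

/-- A permutation preserving both rows and columns is trivial, so the identity arises only as 1 * 1
and has coefficient 1. -/
theorem youngSymmetrizer_ne_zero {n : ℕ} {nu : YoungDiagram} (e : Fin n ≃ nu.cells) :
    youngSymmetrizer e ≠ 0 := by
  classical
  intro h
  have h1 : (youngSymmetrizer e).coeff 1 = 1 := by
    rw [youngSymmetrizer, sum_mul_sum, MonoidAlgebra.coeff_sum, Finsupp.finsetSum_apply,
      sum_eq_single (1 : Equiv.Perm (Fin n))]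
    · rw [MonoidAlgebra.coeff_sum, Finsupp.finsetSum_apply,
        sum_eq_single (1 : Equiv.Perm (Fin n))]
      · simp [MonoidAlgebra.single_mul_single]
      · intro b _ hb
        rw [MonoidAlgebra.single_mul_single, MonoidAlgebra.coeff_single, Finsupp.single_apply,
          if_neg (by simpa using hb)]
      · intro h
        exact absurd (mem_filter.2 ⟨mem_univ _, (colSubgroup e).one_mem⟩) h
    · intro a ha hne
      rw [MonoidAlgebra.coeff_sum, Finsupp.finsetSum_apply]
      refine sum_eq_zero fun b hb => ?_
      rw [MonoidAlgebra.single_mul_single, MonoidAlgebra.coeff_single, Finsupp.single_apply,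
        if_neg]
      intro hab
      refine hne (Equiv.ext fun k => e.injective (Subtype.ext (Prod.ext ?_ ?_)))
      · exact (mem_filter.1 ha).2 k
      · have hai : a ∈ colGroup e := by
          rw [eq_inv_of_mul_eq_one_left hab]
          exact (colSubgroup e).inv_mem (mem_filter.1 hb).2
        exact hai k
    · intro h
      exact absurd (mem_filter.2 ⟨mem_univ _, (rowSubgroup e).one_mem⟩) h
  rw [h] at h1
  simp at h1

/-! ### Row group invariants and independence of the irreducible characters -/

/-- The restriction of a Specht module to the row group of another numbering. -/
noncomputable def spechtRes {n : ℕ} {mu nu : YoungDiagram} (e : Fin n ≃ mu.cells)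
    (e' : Fin n ≃ nu.cells) :
    Representation ℂ (rowSubgroup e)
      (Ideal.span {youngSymmetrizer e'} : Ideal (MonoidAlgebra ℂ (Equiv.Perm (Fin n)))) :=
  (spechtRep e').comp (rowSubgroup e).subtype

instance finite_ideal_groupAlgebra {n : ℕ}
    (I : Ideal (MonoidAlgebra ℂ (Equiv.Perm (Fin n)))) : FiniteDimensional ℂ I := by
  have : FiniteDimensional ℂ (MonoidAlgebra ℂ (Equiv.Perm (Fin n))) :=
    inferInstance
  exact FiniteDimensional.finiteDimensional_submodule (I.restrictScalars ℂ)

/-- The row sum multiplies an invariant vector by the order of the row group, but it annihilates the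
whole Specht module of `e'` by `rowSum_mul_mul_colSum_eq_zero`. -/
theorem spechtRes_invariants_eq_bot {n : ℕ} {mu nu : YoungDiagram} (e : Fin n ≃ mu.cells)
    (e' : Fin n ≃ nu.cells) (h : ¬ boxesAbove mu ≤ boxesAbove nu) :
    (spechtRes e e').invariants = ⊥ := by
  classical
  rw [eq_bot_iff]
  intro x hx
  rw [Representation.mem_invariants] at hx
  have hfix : ∀ g ∈ rowGroup e, MonoidAlgebra.single g (1 : ℂ) * x.1 = x.1 := by
    intro g hg
    have := congrArg Subtype.val (hx ⟨g, hg⟩)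
    exact this
  obtain ⟨y, hy⟩ := Ideal.mem_span_singleton'.1 x.2
  have h0 : rowSum e * x.1 = 0 := by
    rw [← hy, youngSymmetrizer_eq, ← mul_assoc, ← mul_assoc, mul_assoc (rowSum e) y]
    exact rowSum_mul_mul_colSum_eq_zero e e' h _
  have h1 : rowSum e * x.1 = ((univ.filter (· ∈ rowGroup e)).card : ℂ) • x.1 := by
    rw [rowSum, sum_mul, sum_congr rfl (fun g hg => hfix g (mem_filter.1 hg).2), sum_const,
      Nat.cast_smul_eq_nsmul]
  rw [h0] at h1
  have h2 : ((univ.filter (· ∈ rowGroup e)).card : ℂ) ≠ 0 := by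
    rw [Nat.cast_ne_zero]
    exact card_ne_zero_of_mem (mem_filter.2 ⟨mem_univ _, (rowSubgroup e).one_mem⟩)
  exact (Submodule.mem_bot ℂ).2 (Subtype.ext ((smul_eq_zero.1 h1.symm).resolve_left h2))

theorem spechtRes_invariants_ne_bot {n : ℕ} {nu : YoungDiagram} (e : Fin n ≃ nu.cells) :
    (spechtRes e e).invariants ≠ ⊥ := by
  intro h
  have hmem : (⟨youngSymmetrizer e, Ideal.mem_span_singleton_self _⟩ :
      (Ideal.span {youngSymmetrizer e} : Ideal (MonoidAlgebra ℂ (Equiv.Perm (Fin n))))) ∈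
      (spechtRes e e).invariants := by
    rw [Representation.mem_invariants]
    rintro ⟨g, hg⟩
    refine Subtype.ext ?_
    change MonoidAlgebra.single g (1 : ℂ) * youngSymmetrizer e = youngSymmetrizer e
    rw [youngSymmetrizer_eq, ← mul_assoc, single_mul_rowSum e hg]
  rw [h] at hmem
  exact youngSymmetrizer_ne_zero e (congrArg Subtype.val ((Submodule.mem_bot ℂ).1 hmem))

theorem sum_rowSubgroup_character {n : ℕ} {mu nu : YoungDiagram} (e : Fin n ≃ mu.cells)
    (e' : Fin n ≃ nu.cells) [Fintype (rowSubgroup e)] :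
    (Nat.card (rowSubgroup e) : ℂ)⁻¹ * ∑ g : rowSubgroup e, (spechtRep e').character g =
      Module.finrank ℂ (spechtRes e e').invariants := by
  have : Invertible (Nat.card (rowSubgroup e) : ℂ) :=
    invertibleOfNonzero (Nat.cast_ne_zero.2 Nat.card_pos.ne')
  have : Invertible (Fintype.card (rowSubgroup e) : ℂ) :=
    invertibleOfNonzero (Nat.cast_ne_zero.2 Fintype.card_ne_zero)
  have := Representation.card_inv_mul_sum_char_eq_finrank (spechtRes e e')
  rw [← this]
  rfl

/-- The characters `irrChar nu` of the partitions of `n` are linearly independent. -/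
theorem linearIndependent_irrChar (n : ℕ) :
    LinearIndependent ℂ (irrChar : PartitionOf n → Equiv.Perm (Fin n) → ℂ) := by
  classical
  rw [Fintype.linearIndependent_iff]
  intro f hf
  by_contra hne
  push Not at hne
  let S : Set (PartitionOf n) := {nu | f nu ≠ 0}
  obtain ⟨mu, hmu, hmax⟩ := (Set.toFinite S).exists_maximalFor
    (fun nu : PartitionOf n => boxesAbove nu.1) S hne
  let e : ∀ nu : PartitionOf n, Fin n ≃ nu.1.cells := fun nu =>
    (Finset.equivFinOfCardEq nu.2).symm
  -- Averaging the relation over the row group of mu replaces each character by a dimension of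
  -- invariants. As mu is maximal in the support, only its own term survives.
  have h1 : ∑ nu : PartitionOf n,
      f nu * (Module.finrank ℂ (spechtRes (e mu) (e nu)).invariants : ℂ) = 0 := by
    simp_rw [← sum_rowSubgroup_character, mul_left_comm (f _), ← mul_sum]
    refine mul_eq_zero_of_right _ ?_
    simp_rw [mul_sum]
    rw [sum_comm]
    refine sum_eq_zero fun g _ => ?_
    have := congrFun hf g.1
    simpa [Finset.sum_apply, irrChar, e] using this
  rw [sum_eq_single mu] at h1
  · have h2 := (mul_eq_zero.1 h1).resolve_left hmu
    rw [Nat.cast_eq_zero, Submodule.finrank_eq_zero] at h2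
    exact spechtRes_invariants_ne_bot (e mu) h2
  · intro nu _ hnu
    by_cases hf0 : f nu = 0
    · rw [hf0, zero_mul]
    · rw [spechtRes_invariants_eq_bot, finrank_bot, Nat.cast_zero, mul_zero]
      intro hle
      exact hnu (Subtype.ext (boxesAbove_injective (le_antisymm (hmax hf0 hle) hle)))
  · simp

theorem lrCoeff_eq_of_skewChar_eq {n : ℕ} {lam mu al be : YoungDiagram}
    (h : skewChar n lam mu = skewChar n al be) (nu : YoungDiagram) (hnu : nu.card = n) :
    lrCoeff lam mu nu = lrCoeff al be nu := by
  have hli := linearIndependent_irrChar n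
  rw [Fintype.linearIndependent_iff] at hli
  have := hli (fun nu => (lrCoeff lam mu nu.1 : ℂ) - lrCoeff al be nu.1) (by
    simp_rw [sub_smul, Nat.cast_smul_eq_nsmul]
    rw [sum_sub_distrib, sub_eq_zero]
    exact h) ⟨nu, hnu⟩
  exact_mod_cast sub_eq_zero.1 this

/-! ### Lattice words and counts of letters -/

theorem mem_skewDiagram_row {lam mu : YoungDiagram} {i j : ℕ} :
    (i, j) ∈ skewDiagram lam mu ↔ mu.rowLen i ≤ j ∧ j < lam.rowLen i := by
  rw [skewDiagram, mem_sdiff, YoungDiagram.mem_cells, YoungDiagram.mem_cells,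
    YoungDiagram.mem_iff_lt_rowLen, YoungDiagram.mem_iff_lt_rowLen, not_lt, and_comm]

theorem mem_skewDiagram_col {lam mu : YoungDiagram} {i j : ℕ} :
    (i, j) ∈ skewDiagram lam mu ↔ mu.colLen j ≤ i ∧ i < lam.colLen j := by
  rw [skewDiagram, mem_sdiff, YoungDiagram.mem_cells, YoungDiagram.mem_cells,
    YoungDiagram.mem_iff_lt_colLen, YoungDiagram.mem_iff_lt_colLen, not_lt, and_comm]

/-- The number of entries `v` among the boxes of `lam / mu` that the reverse row reading meets
before it passes to the left of column `j` in row `i`. -/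
def letterCount (lam mu : YoungDiagram) (T : ℕ → ℕ → ℕ) (v i j : ℕ) : ℕ :=
  ((skewDiagram lam mu).filter fun x =>
    T x.1 x.2 = v ∧ (x.1 < i ∨ x.1 = i ∧ j ≤ x.2)).card

/-- The reverse row word of the row `i`. -/
def rowWord (lam mu : YoungDiagram) (T : ℕ → ℕ → ℕ) (i : ℕ) : List ℕ :=
  (List.range (lam.rowLen i - mu.rowLen i)).map fun t => T i (lam.rowLen i - 1 - t)

/-- The reverse row word of the first `N` rows. -/
def rowsWord (lam mu : YoungDiagram) (T : ℕ → ℕ → ℕ) (N : ℕ) : List ℕ :=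
  (List.range N).flatMap (rowWord lam mu T)

theorem filter_le_range (a b : ℕ) :
    (List.range b).filter (fun j => a ≤ j) = List.range' a (b - a) := by
  induction b with
  | zero => simp
  | succ b ih =>
    rw [List.range_succ, List.filter_append, ih]
    by_cases h : a ≤ b
    · rw [Nat.succ_sub h, List.range'_concat]
      simp [h]
    · have : b + 1 - a = 0 := by omega
      have h2 : b - a = 0 := by omega
      simp [h, this, h2]

theorem rowWord_eq (lam mu : YoungDiagram) (T : ℕ → ℕ → ℕ) (i : ℕ) :
    (((List.range (lam.rowLen i)).filter fun j => mu.rowLen i ≤ j).reverse).map (T i) =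
      rowWord lam mu T i := by
  rw [filter_le_range, List.reverse_range', List.map_map, rowWord]
  refine List.map_congr_left fun t ht => ?_
  rw [List.mem_range] at ht
  simp only [Function.comp_apply]
  congr 1
  omega

theorem reverseRowWord_eq (lam mu : YoungDiagram) (T : ℕ → ℕ → ℕ) :
    reverseRowWord lam mu T = rowsWord lam mu T (lam.colLen 0) := by
  rw [reverseRowWord, rowsWord]
  congr 1
  funext i
  exact rowWord_eq lam mu T i

theorem rowsWord_succ (lam mu : YoungDiagram) (T : ℕ → ℕ → ℕ) (N : ℕ) :
    rowsWord lam mu T (N + 1) = rowsWord lam mu T N ++ rowWord lam mu T N := by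
  simp [rowsWord, List.range_succ]

theorem rowLen_eq_zero {lam : YoungDiagram} {i : ℕ} (h : lam.colLen 0 ≤ i) :
    lam.rowLen i = 0 := by
  by_contra hne
  have : (i, 0) ∈ lam := YoungDiagram.mem_iff_lt_rowLen.2 (Nat.pos_of_ne_zero hne)
  rw [YoungDiagram.mem_iff_lt_colLen] at this
  omega

theorem reverseRowWord_eq_of_le (lam mu : YoungDiagram) (T : ℕ → ℕ → ℕ) {N : ℕ}
    (hN : lam.colLen 0 ≤ N) : reverseRowWord lam mu T = rowsWord lam mu T N := by
  rw [reverseRowWord_eq]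
  induction N, hN using Nat.le_induction with
  | base => rfl
  | succ N hN ih =>
    rw [rowsWord_succ, ih, rowWord, rowLen_eq_zero hN]
    simp

theorem count_take_rowWord (lam mu : YoungDiagram) (T : ℕ → ℕ → ℕ) (v i r : ℕ) :
    ((rowWord lam mu T i).take r).count v =
      ((skewDiagram lam mu).filter fun x =>
        T x.1 x.2 = v ∧ (x.1 = i ∧ lam.rowLen i - r ≤ x.2)).card := by
  have h1 : (rowWord lam mu T i).take r =
      (List.range (min r (lam.rowLen i - mu.rowLen i))).map fun t => T i (lam.rowLen i - 1 - t) := by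
    rw [rowWord, ← List.map_take, List.take_range]
  rw [h1, List.count, List.countP_map]
  have h2 : ∀ (p : ℕ → Bool) (m : ℕ), (List.range m).countP p = ((range m).filter (p ·)).card := by
    intro p m
    rw [List.countP_eq_length_filter]
    simp [Finset.card_def, Finset.range, Multiset.range, Finset.filter]
  rw [h2]
  refine card_bij' (fun t _ => (i, lam.rowLen i - 1 - t)) (fun x _ => lam.rowLen i - 1 - x.2)
    ?_ ?_ ?_ ?_
  · intro t ht
    simp only [mem_filter, mem_range, Function.comp_apply, beq_iff_eq, lt_min_iff] at ht
    simp only [mem_filter, mem_skewDiagram_row]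
    refine ⟨⟨?_, ?_⟩, ht.2, trivial, ?_⟩ <;> omega
  · rintro ⟨i', x⟩ hx
    simp only [mem_filter, mem_skewDiagram_row] at hx
    obtain ⟨⟨ha, hb⟩, hT, rfl, hr⟩ := hx
    simp only [mem_filter, mem_range, Function.comp_apply, beq_iff_eq, lt_min_iff]
    refine ⟨⟨by omega, by omega⟩, ?_⟩
    rw [← hT]
    congr 1
    omega
  · intro t ht
    simp only [mem_filter, mem_range, lt_min_iff] at ht
    simp only
    omega
  · rintro ⟨i', x⟩ hx
    simp only [mem_filter, mem_skewDiagram_row] at hx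
    obtain ⟨⟨ha, hb⟩, hT, rfl, hr⟩ := hx
    simp only [Prod.mk.injEq, true_and]
    omega

theorem count_rowsWord (lam mu : YoungDiagram) (T : ℕ → ℕ → ℕ) (v N : ℕ) :
    (rowsWord lam mu T N).count v =
      ((skewDiagram lam mu).filter fun x => T x.1 x.2 = v ∧ x.1 < N).card := by
  induction N with
  | zero => simp [rowsWord]
  | succ N ih =>
    have h := count_take_rowWord lam mu T v N (lam.rowLen N)
    rw [List.take_of_length_le (by simp [rowWord])] at h
    rw [rowsWord_succ, List.count_append, ih, h, ← card_union_of_disjoint]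
    · congr 1
      ext x
      simp only [mem_union, mem_filter, Nat.sub_self, Nat.zero_le, and_true]
      grind
    · rw [disjoint_filter]
      intro x _ h1 h2
      omega

theorem count_rowsWord_append (lam mu : YoungDiagram) (T : ℕ → ℕ → ℕ) (v i r : ℕ) :
    (rowsWord lam mu T i ++ (rowWord lam mu T i).take r).count v =
      letterCount lam mu T v i (lam.rowLen i - r) := by
  rw [List.count_append, count_rowsWord, count_take_rowWord, letterCount,
    ← card_union_of_disjoint]
  · congr 1
    ext x
    simp only [mem_union, mem_filter]
    tauto
  · rw [disjoint_filter]
    intro x _ h1 h2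
    omega

theorem letterCount_min (lam mu : YoungDiagram) (T : ℕ → ℕ → ℕ) (v i j : ℕ) :
    letterCount lam mu T v i (lam.rowLen i - (lam.rowLen i - j)) =
      letterCount lam mu T v i j := by
  rw [letterCount, letterCount]
  congr 1
  refine filter_congr ?_
  rintro ⟨i', x⟩ hx
  rw [mem_skewDiagram_row] at hx
  have : i' = i → x < lam.rowLen i := by rintro rfl; exact hx.2
  simp only
  constructor
  · rintro ⟨h, h' | ⟨h', h''⟩⟩
    · exact ⟨h, Or.inl h'⟩
    · exact ⟨h, Or.inr ⟨h', by have := this h'; omega⟩⟩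
  · rintro ⟨h, h' | ⟨h', h''⟩⟩
    · exact ⟨h, Or.inl h'⟩
    · exact ⟨h, Or.inr ⟨h', by have := this h'; omega⟩⟩

theorem exists_take_rowsWord (lam mu : YoungDiagram) (T : ℕ → ℕ → ℕ) (n N : ℕ) :
    ∃ i r, (rowsWord lam mu T N).take n =
      rowsWord lam mu T i ++ (rowWord lam mu T i).take r := by
  induction N with
  | zero => exact ⟨0, 0, by simp [rowsWord]⟩
  | succ N ih =>
    rw [rowsWord_succ]
    rcases le_total n (rowsWord lam mu T N).length with h | h
    · obtain ⟨i, r, hir⟩ := ih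
      exact ⟨i, r, by rw [List.take_append_of_le_length h, hir]⟩
    · exact ⟨N, n - (rowsWord lam mu T N).length, by
        rw [List.take_append, List.take_of_length_le h]⟩

theorem rowsWord_prefix (lam mu : YoungDiagram) (T : ℕ → ℕ → ℕ) {M N : ℕ} (h : M ≤ N) :
    rowsWord lam mu T M <+: rowsWord lam mu T N := by
  induction N, h using Nat.le_induction with
  | base => exact List.prefix_rfl
  | succ N _ ih =>
    rw [rowsWord_succ]
    exact ih.trans (List.prefix_append _ _)

/-- Every prefix of the word stops inside some row, so prefixes can be indexed by positions (i, j);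
all later arguments about lattice words are counts of boxes. -/
theorem isLatticeWord_reverseRowWord_iff (lam mu : YoungDiagram) (T : ℕ → ℕ → ℕ) :
    IsLatticeWord (reverseRowWord lam mu T) ↔
      ∀ i j k, 1 ≤ k → letterCount lam mu T (k + 1) i j ≤ letterCount lam mu T k i j := by
  constructor
  · intro h i j k hk
    -- Empty rows add nothing to the word, so row i may be taken to be among the rows read even if
    -- it lies below lam.
    rw [reverseRowWord_eq_of_le lam mu T (le_max_left _ (i + 1))] at h
    have hp : rowsWord lam mu T i ++ (rowWord lam mu T i).take (lam.rowLen i - j) <+: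
        rowsWord lam mu T (max (lam.colLen 0) (i + 1)) := by
      refine List.IsPrefix.trans ?_ (rowsWord_prefix lam mu T (le_max_right _ _))
      rw [rowsWord_succ, List.prefix_append_right_inj]
      exact List.take_prefix _ _
    have := h (rowsWord lam mu T i ++ (rowWord lam mu T i).take (lam.rowLen i - j)).length k hk
    rw [← List.prefix_iff_eq_take.1 hp, count_rowsWord_append, count_rowsWord_append,
      letterCount_min, letterCount_min] at this
    exact this
  · intro h n k hk
    rw [reverseRowWord_eq]
    obtain ⟨i, r, hir⟩ := exists_take_rowsWord lam mu T n (lam.colLen 0)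
    rw [hir, count_rowsWord_append, count_rowsWord_append]
    exact h _ _ k hk

/-! ### Littlewood–Richardson fillings of arbitrary content -/

/-- Littlewood–Richardson tableaux of shape `lam / mu` of unspecified content. -/
structure IsLRFilling (lam mu : YoungDiagram) (T : ℕ → ℕ → ℕ) : Prop where
  pos : ∀ i j, (i, j) ∈ skewDiagram lam mu → 0 < T i j
  zero : ∀ i j, (i, j) ∉ skewDiagram lam mu → T i j = 0
  row_weak : ∀ i j, (i, j) ∈ skewDiagram lam mu → (i, j + 1) ∈ skewDiagram lam mu →
    T i j ≤ T i (j + 1)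
  col_strict : ∀ i j, (i, j) ∈ skewDiagram lam mu → (i + 1, j) ∈ skewDiagram lam mu →
    T i j < T (i + 1) j
  lattice : ∀ i j k, 1 ≤ k → letterCount lam mu T (k + 1) i j ≤ letterCount lam mu T k i j

/-- The number of entries `v` of a filling of `lam / mu`. -/
def content (lam mu : YoungDiagram) (T : ℕ → ℕ → ℕ) (v : ℕ) : ℕ :=
  ((skewDiagram lam mu).filter fun x => T x.1 x.2 = v).card

/-- The number of entries `v` in the first `i` rows of a filling of `lam / mu`. -/
def rowsContent (lam mu : YoungDiagram) (T : ℕ → ℕ → ℕ) (v i : ℕ) : ℕ :=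
  ((skewDiagram lam mu).filter fun x => T x.1 x.2 = v ∧ x.1 < i).card

theorem fst_lt_colLen_zero {lam mu : YoungDiagram} {x : ℕ × ℕ} (hx : x ∈ skewDiagram lam mu) :
    x.1 < lam.colLen 0 := by
  obtain ⟨i, j⟩ := x
  exact (mem_skewDiagram_col.1 hx).2.trans_le (lam.colLen_anti _ _ (Nat.zero_le _))

theorem snd_lt_rowLen_zero {lam mu : YoungDiagram} {x : ℕ × ℕ} (hx : x ∈ skewDiagram lam mu) :
    x.2 < lam.rowLen 0 := by
  obtain ⟨i, j⟩ := x
  exact (mem_skewDiagram_row.1 hx).2.trans_le (lam.rowLen_anti _ _ (Nat.zero_le _))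

theorem rowsContent_eq_content {lam mu : YoungDiagram} {T : ℕ → ℕ → ℕ} {v i : ℕ}
    (h : lam.colLen 0 ≤ i) : rowsContent lam mu T v i = content lam mu T v := by
  rw [rowsContent, content]
  congr 1
  refine filter_congr fun x hx => ?_
  have := fst_lt_colLen_zero hx
  simp only [and_iff_left_iff_imp]
  intro _
  omega

theorem letterCount_eq_content {lam mu : YoungDiagram} {T : ℕ → ℕ → ℕ} {v j : ℕ} :
    letterCount lam mu T v (lam.colLen 0) j = content lam mu T v := by
  rw [letterCount, content]
  congr 1
  refine filter_congr fun x hx => ?_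
  have := fst_lt_colLen_zero hx
  simp only [and_iff_left_iff_imp]
  intro _
  omega

theorem IsLRFilling.content_succ_le {lam mu : YoungDiagram} {T : ℕ → ℕ → ℕ}
    (h : IsLRFilling lam mu T) {k : ℕ} (hk : 1 ≤ k) :
    content lam mu T (k + 1) ≤ content lam mu T k := by
  have := h.lattice (lam.colLen 0) 0 k hk
  rwa [letterCount_eq_content, letterCount_eq_content] at this

theorem IsLRFilling.content_anti {lam mu : YoungDiagram} {T : ℕ → ℕ → ℕ}
    (h : IsLRFilling lam mu T) : Antitone fun k => content lam mu T (k + 1) :=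
  antitone_nat_of_succ_le fun k => h.content_succ_le (Nat.le_add_left 1 k)

theorem LRTableau.isLRFilling {lam mu nu : YoungDiagram} (t : LRTableau lam mu nu) :
    IsLRFilling lam mu t.entry :=
  ⟨t.pos, t.zero, t.row_weak, t.col_strict,
    (isLatticeWord_reverseRowWord_iff _ _ _).1 t.lattice⟩

theorem LRTableau.content_eq {lam mu nu : YoungDiagram} (t : LRTableau lam mu nu) (k : ℕ) :
    SkewChar.content lam mu t.entry (k + 1) = nu.rowLen k := t.content k

/-- The content of a Littlewood–Richardson filling is a partition. -/
theorem IsLRFilling.exists_lrTableau {lam mu : YoungDiagram} {T : ℕ → ℕ → ℕ}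
    (h : IsLRFilling lam mu T) :
    ∃ nu : YoungDiagram, nu.card = (skewDiagram lam mu).card ∧
      (∀ k, nu.rowLen k = content lam mu T (k + 1)) ∧ Nonempty (LRTableau lam mu nu) := by
  -- Any upper bound for the entries would do; it makes the set of boxes of nu finite.
  let M := ∑ x ∈ skewDiagram lam mu, T x.1 x.2
  have hM : ∀ x ∈ skewDiagram lam mu, T x.1 x.2 ≤ M := fun x hx =>
    single_le_sum (f := fun x : ℕ × ℕ => T x.1 x.2) (fun _ _ => Nat.zero_le _) hx
  let nu : YoungDiagram :=
    { cells := (range M).sigma (fun k => range (content lam mu T (k + 1))) |>.map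
        (Equiv.sigmaEquivProd ℕ ℕ).toEmbedding
      isLowerSet := by
        rintro ⟨a, b⟩ ⟨a', b'⟩ hle hmem
        have hle' : a' ≤ a ∧ b' ≤ b := hle
        simp only [coe_map, Set.mem_image, mem_coe, mem_sigma, mem_range] at hmem ⊢
        obtain ⟨⟨x, y⟩, ⟨hx, hy⟩, hxy⟩ := hmem
        simp only [Equiv.coe_toEmbedding, Equiv.sigmaEquivProd_apply, Prod.mk.injEq] at hxy
        obtain ⟨rfl, rfl⟩ := hxy
        refine ⟨⟨a', b'⟩, ⟨hle'.1.trans_lt hx, ?_⟩, rfl⟩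
        exact (hle'.2.trans_lt hy).trans_le (h.content_anti hle'.1) }
  have hcard : nu.card = ∑ k ∈ range M, content lam mu T (k + 1) := by
    change (Finset.map _ _).card = _
    rw [card_map, card_sigma]
    simp
  have hmem : ∀ i j, (i, j) ∈ nu ↔ j < content lam mu T (i + 1) := by
    intro i j
    rw [← YoungDiagram.mem_cells]
    simp only [nu, mem_map, mem_sigma, mem_range, Equiv.coe_toEmbedding,
      Equiv.sigmaEquivProd_apply]
    constructor
    · rintro ⟨⟨x, y⟩, ⟨_, hy⟩, hxy⟩
      simp only [Prod.mk.injEq] at hxy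
      obtain ⟨rfl, rfl⟩ := hxy
      exact hy
    · intro hj
      refine ⟨⟨i, j⟩, ⟨?_, hj⟩, rfl⟩
      have : content lam mu T (i + 1) ≠ 0 := by omega
      rw [content, card_ne_zero] at this
      obtain ⟨x, hx⟩ := this
      rw [mem_filter] at hx
      have h1 := hM x hx.1
      have h2 := hx.2
      change i < M
      omega
  have hrow : ∀ k, nu.rowLen k = content lam mu T (k + 1) := by
    intro k
    refine eq_of_forall_lt_iff fun j => ?_
    rw [← YoungDiagram.mem_iff_lt_rowLen, hmem]
  refine ⟨nu, ?_, hrow, ⟨⟨T, h.pos, h.zero, h.row_weak, h.col_strict, fun k => ?_,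
    (isLatticeWord_reverseRowWord_iff _ _ _).2 h.lattice⟩⟩⟩
  · rw [hcard, card_eq_sum_card_fiberwise (f := fun x => T x.1 x.2 - 1) (t := range M)]
    · refine sum_congr rfl fun k _ => ?_
      rw [content]
      congr 1
      refine filter_congr ?_
      rintro ⟨i, j⟩ hx
      have := h.pos i j hx
      simp only
      omega
    · rintro ⟨i, j⟩ hx
      have := h.pos i j hx
      have := hM _ hx
      simp only [coe_range, Set.mem_Iio]
      simp only at this
      omega
  · rw [hrow]
    rfl

theorem finite_lrTableau (lam mu nu : YoungDiagram) : Finite (LRTableau lam mu nu) := by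
  have hlt : ∀ (t : LRTableau lam mu nu) (x : skewDiagram lam mu),
      t.entry x.1.1 x.1.2 < nu.colLen 0 + 1 := by
    rintro t ⟨⟨i, j⟩, hx⟩
    have hp := t.pos i j hx
    have hc := t.content (t.entry i j - 1)
    have hne : 0 < nu.rowLen (t.entry i j - 1) := by
      rw [← hc, card_pos]
      exact ⟨(i, j), mem_filter.2 ⟨hx, by simp only; omega⟩⟩
    have := YoungDiagram.mem_iff_lt_colLen.1 (YoungDiagram.mem_iff_lt_rowLen.2 hne)
    simp only
    omega
  refine Finite.of_injective (fun (t : LRTableau lam mu nu) (x : skewDiagram lam mu) =>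
    (⟨t.entry x.1.1 x.1.2, hlt t x⟩ : Fin (nu.colLen 0 + 1))) ?_
  intro s t hst
  have : s.entry = t.entry := by
    funext i j
    by_cases hx : (i, j) ∈ skewDiagram lam mu
    · have := congrFun hst ⟨(i, j), hx⟩
      simpa using this
    · rw [s.zero i j hx, t.zero i j hx]
  cases s
  cases t
  congr

/-- If two skew characters agree, then the same contents occur among the Littlewood–Richardson
fillings of the two diagrams. -/
theorem exists_filling_of_skewChar_eq {n : ℕ} {lam mu al be : YoungDiagram}
    (hn : (skewDiagram lam mu).card = n) (h : skewChar n lam mu = skewChar n al be)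
    {T : ℕ → ℕ → ℕ} (hT : IsLRFilling lam mu T) :
    ∃ T', IsLRFilling al be T' ∧ ∀ v, 1 ≤ v → content al be T' v = content lam mu T v := by
  obtain ⟨nu, hcard, hrow, hne⟩ := hT.exists_lrTableau
  have hfin := finite_lrTableau lam mu nu
  have hpos : lrCoeff lam mu nu ≠ 0 := Nat.card_pos.ne'
  rw [lrCoeff_eq_of_skewChar_eq h nu (hcard.trans hn)] at hpos
  obtain ⟨⟨t⟩, _⟩ := Nat.card_ne_zero.1 hpos
  refine ⟨t.entry, t.isLRFilling, fun v hv => ?_⟩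
  obtain ⟨k, rfl⟩ := Nat.exists_eq_add_of_le' hv
  rw [t.content_eq, hrow]

/-! ### Bounds on the content of a Littlewood–Richardson filling -/

namespace IsLRFilling

variable {lam mu : YoungDiagram} {T : ℕ → ℕ → ℕ}

theorem row_mono (h : IsLRFilling lam mu T) {i j j' : ℕ} (hj : (i, j) ∈ skewDiagram lam mu)
    (hj' : (i, j') ∈ skewDiagram lam mu) (hle : j ≤ j') : T i j ≤ T i j' := by
  induction j', hle using Nat.le_induction with
  | base => exact le_rfl
  | succ k hk ih =>
    have hmem : (i, k) ∈ skewDiagram lam mu := by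
      rw [mem_skewDiagram_row] at hj hj' ⊢
      omega
    exact (ih hmem).trans (h.row_weak i k hmem hj')

theorem col_add_le (h : IsLRFilling lam mu T) {i i' j : ℕ} (hi : (i, j) ∈ skewDiagram lam mu)
    (hi' : (i', j) ∈ skewDiagram lam mu) (hle : i ≤ i') : T i j + (i' - i) ≤ T i' j := by
  induction i', hle using Nat.le_induction with
  | base => simp
  | succ k hk ih =>
    have hmem : (k, j) ∈ skewDiagram lam mu := by
      rw [mem_skewDiagram_col] at hi hi' ⊢
      omega
    have h1 := ih hmem
    have h2 := h.col_strict k j hmem hi'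
    omega

theorem le_entry (h : IsLRFilling lam mu T) {i j : ℕ} (hi : (i, j) ∈ skewDiagram lam mu) :
    i - mu.colLen j + 1 ≤ T i j := by
  have hc := mem_skewDiagram_col.1 hi
  have hmem : (mu.colLen j, j) ∈ skewDiagram lam mu := by
    rw [mem_skewDiagram_col]
    omega
  have h1 := h.col_add_le hmem hi hc.1
  have h2 := h.pos _ _ hmem
  omega

theorem eq_of_col (h : IsLRFilling lam mu T) {x y : ℕ × ℕ} (hx : x ∈ skewDiagram lam mu)
    (hy : y ∈ skewDiagram lam mu) (hT : T x.1 x.2 = T y.1 y.2) (hxy : x.2 = y.2) : x = y := by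
  obtain ⟨i, j⟩ := x
  obtain ⟨i', j'⟩ := y
  simp only at hT hxy
  subst hxy
  rcases le_total i i' with hle | hle
  · have := h.col_add_le hx hy hle
    rw [Prod.mk.injEq]
    omega
  · have := h.col_add_le hy hx hle
    rw [Prod.mk.injEq]
    omega

/-- An entry v + 1 > 1 must be preceded by an entry v. The entries to its right in the same row are
at least v + 1, so v occurs in a higher row and induction applies. -/
theorem entry_le (h : IsLRFilling lam mu T) {i j : ℕ} (hi : (i, j) ∈ skewDiagram lam mu) :
    T i j ≤ i + 1 := by
  induction i using Nat.strong_induction_on generalizing j with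
  | _ i ih =>
    by_contra hcon
    push Not at hcon
    obtain ⟨v, hv⟩ : ∃ v, T i j = v + 1 := ⟨T i j - 1, by omega⟩
    have hl := h.lattice i j v (by omega)
    have hpos : 0 < letterCount lam mu T (v + 1) i j :=
      card_pos.2 ⟨(i, j), mem_filter.2 ⟨hi, hv, Or.inr ⟨rfl, le_rfl⟩⟩⟩
    obtain ⟨⟨i', j'⟩, hx⟩ := card_pos.1 (hpos.trans_le hl)
    rw [mem_filter] at hx
    obtain ⟨hmem, hT, hlt | ⟨heq, hle⟩⟩ := hx
    · have := ih i' hlt hmem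
      simp only at hT hlt
      omega
    · simp only at hT heq hle
      subst heq
      have := h.row_mono hi hmem hle
      omega

/-- Stop the reading of row i at its leftmost entry ≥ v + 1, or before the row if there is none:
every v + 1 of the row has then been met, but no v of that row. -/
theorem rowsContent_succ_le (h : IsLRFilling lam mu T) {v : ℕ} (hv : 1 ≤ v) (i : ℕ) :
    rowsContent lam mu T (v + 1) (i + 1) ≤ rowsContent lam mu T v i := by
  classical
  by_cases hex : ∃ j, (i, j) ∈ skewDiagram lam mu ∧ v + 1 ≤ T i j
  · have hspec := Nat.find_spec hex
    have hmin : ∀ j, (i, j) ∈ skewDiagram lam mu → v + 1 ≤ T i j → Nat.find hex ≤ j :=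
      fun j h1 h2 => Nat.find_min' hex ⟨h1, h2⟩
    refine le_trans (card_le_card ?_) ((h.lattice i (Nat.find hex) v hv).trans (card_le_card ?_))
    · rintro ⟨i', j'⟩ hx
      simp only [mem_filter] at hx ⊢
      refine ⟨hx.1, hx.2.1, ?_⟩
      rcases Nat.lt_succ_iff_lt_or_eq.1 hx.2.2 with hlt | rfl
      · exact Or.inl hlt
      · exact Or.inr ⟨rfl, hmin j' hx.1 hx.2.1.ge⟩
    · rintro ⟨i', j'⟩ hx
      simp only [mem_filter] at hx ⊢
      refine ⟨hx.1, hx.2.1, ?_⟩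
      rcases hx.2.2 with hlt | ⟨rfl, hle⟩
      · exact hlt
      · have := h.row_mono hspec.1 hx.1 hle
        omega
  · push Not at hex
    refine le_trans (card_le_card ?_) ((h.lattice i (lam.rowLen i) v hv).trans (card_le_card ?_))
    · rintro ⟨i', j'⟩ hx
      simp only [mem_filter] at hx ⊢
      refine ⟨hx.1, hx.2.1, ?_⟩
      rcases Nat.lt_succ_iff_lt_or_eq.1 hx.2.2 with hlt | rfl
      · exact Or.inl hlt
      · have := hex j' hx.1
        omega
    · rintro ⟨i', j'⟩ hx
      simp only [mem_filter] at hx ⊢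
      refine ⟨hx.1, hx.2.1, ?_⟩
      rcases hx.2.2 with hlt | ⟨rfl, hle⟩
      · exact hlt
      · have := (mem_skewDiagram_row.1 hx.1).2
        omega

/-- By descending induction on v: the entries ≥ v + 1 of row i are at most as many as the entries v
+ 1 in the rows up to i, hence as the entries v strictly above row i, and the entries v of row i
itself are added. The induction starts at v ≥ i + 2, where `entry_le` leaves nothing to count. -/
theorem card_row_ge_le (h : IsLRFilling lam mu T) {v : ℕ} (hv : 1 ≤ v) (i : ℕ) :
    ((skewDiagram lam mu).filter fun x => x.1 = i ∧ v ≤ T x.1 x.2).card ≤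
      rowsContent lam mu T v (i + 1) := by
  obtain ⟨d, hd⟩ : ∃ d, i + 2 ≤ v + d := ⟨i + 2, by omega⟩
  induction d generalizing v with
  | zero =>
    rw [card_eq_zero.2]
    · exact Nat.zero_le _
    · rw [filter_eq_empty_iff]
      rintro ⟨i', j'⟩ hx ⟨hi, hle⟩
      simp only at hi hle
      subst hi
      have := h.entry_le hx
      omega
  | succ d ih =>
    have h1 := ih (v := v + 1) (by omega) (by omega)
    have h2 := h.rowsContent_succ_le hv i
    have h3 : ((skewDiagram lam mu).filter fun x => x.1 = i ∧ v ≤ T x.1 x.2).card =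
        ((skewDiagram lam mu).filter fun x => x.1 = i ∧ v = T x.1 x.2).card +
        ((skewDiagram lam mu).filter fun x => x.1 = i ∧ v + 1 ≤ T x.1 x.2).card := by
      rw [← card_union_of_disjoint]
      · congr 1
        ext x
        simp only [mem_union, mem_filter]
        have : v ≤ T x.1 x.2 ↔ v = T x.1 x.2 ∨ v + 1 ≤ T x.1 x.2 := by omega
        tauto
      · rw [disjoint_filter]
        intro x _ h1 h2
        omega
    have h4 : rowsContent lam mu T v (i + 1) =
        ((skewDiagram lam mu).filter fun x => x.1 = i ∧ v = T x.1 x.2).card +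
          rowsContent lam mu T v i := by
      rw [rowsContent, rowsContent, ← card_union_of_disjoint]
      · congr 1
        ext x
        simp only [mem_union, mem_filter]
        have : x.1 < i + 1 ↔ x.1 = i ∨ x.1 < i := by omega
        have : T x.1 x.2 = v ↔ v = T x.1 x.2 := eq_comm
        tauto
      · rw [disjoint_filter]
        intro x _ h1 h2
        omega
    omega

theorem rowsContent_le_content (v i : ℕ) : rowsContent lam mu T v i ≤ content lam mu T v := by
  refine card_le_card fun x hx => ?_
  rw [mem_filter] at hx ⊢
  exact ⟨hx.1, hx.2.1⟩

/-- If the row `i` has entries `≥ v` in the columns `[p, q)`, there are at least `q - p` entries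
`v`. -/
theorem le_content_of_row (h : IsLRFilling lam mu T) {v i p q : ℕ} (hv : 1 ≤ v)
    (hrow : ∀ j, p ≤ j → j < q → (i, j) ∈ skewDiagram lam mu ∧ v ≤ T i j) :
    q - p ≤ content lam mu T v := by
  refine le_trans ?_ ((h.card_row_ge_le hv i).trans (rowsContent_le_content _ _))
  rw [← Nat.card_Ico]
  refine card_le_card_of_injOn (fun j => (i, j)) ?_ ?_
  · intro j hj
    rw [coe_Ico, Set.mem_Ico] at hj
    rw [mem_coe, mem_filter]
    exact ⟨(hrow j hj.1 hj.2).1, rfl, (hrow j hj.1 hj.2).2⟩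
  · intro j _ j' _ hjj
    simpa using hjj

/-- Equal entries lie in different columns, and an entry k + 1 cannot occur above row k. -/
theorem content_le_rowLen (h : IsLRFilling lam mu T) (k : ℕ) :
    content lam mu T (k + 1) ≤ lam.rowLen k := by
  rw [← card_range (lam.rowLen k)]
  refine card_le_card_of_injOn Prod.snd ?_ ?_
  · rintro ⟨i, j⟩ hx
    rw [mem_coe, mem_filter] at hx
    have h1 := h.entry_le hx.1
    have h2 := hx.2
    simp only at h2
    have h3 := lam.rowLen_anti k i (by omega)
    have h4 := (mem_skewDiagram_row.1 hx.1).2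
    simp only [coe_range, Set.mem_Iio]
    omega
  · intro x hx y hy hxy
    rw [mem_coe, mem_filter] at hx hy
    exact h.eq_of_col hx.1 hy.1 (hx.2.trans hy.2.symm) hxy

/-- Every box of this row has at least k boxes of the skew diagram above it, so all its entries are
at least k + 1. -/
theorem rowLen_add_le_content (h : IsLRFilling lam mu T) (k : ℕ) :
    lam.rowLen (mu.colLen 0 + k) ≤ content lam mu T (k + 1) := by
  refine h.le_content_of_row (i := mu.colLen 0 + k) (p := 0) (Nat.le_add_left 1 k)
    fun j _ hj => ?_
  have hmem : (mu.colLen 0 + k, j) ∈ skewDiagram lam mu := by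
    rw [mem_skewDiagram_row, rowLen_eq_zero (Nat.le_add_right _ _)]
    exact ⟨Nat.zero_le _, hj⟩
  have h1 := h.le_entry hmem
  have h2 := mu.colLen_anti 0 j (Nat.zero_le _)
  exact ⟨hmem, by omega⟩

theorem rowLen_sub_le_content (h : IsLRFilling lam mu T) (k : ℕ) :
    lam.rowLen k - mu.rowLen 0 ≤ content lam mu T (k + 1) := by
  refine h.le_content_of_row (i := k) (Nat.le_add_left 1 k) fun j hj hj' => ?_
  have h0 : mu.colLen j = 0 := by
    by_contra hne
    have : (0, j) ∈ mu := YoungDiagram.mem_iff_lt_colLen.2 (Nat.pos_of_ne_zero hne)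
    rw [YoungDiagram.mem_iff_lt_rowLen] at this
    omega
  have hmem : (k, j) ∈ skewDiagram lam mu := by
    rw [mem_skewDiagram_row]
    exact ⟨(mu.rowLen_anti _ _ (Nat.zero_le _)).trans hj, hj'⟩
  have h1 := h.le_entry hmem
  exact ⟨hmem, by omega⟩

/-- The entries 1 of the first m rows lie in distinct columns to the right of `mu.rowLen (m - 1)`.
By `rowsContent_succ_le`, passing to the next letter and one more row does not increase the count,
and after `lam.colLen 0 - m` steps all rows are included. -/
theorem content_le_sub (h : IsLRFilling lam mu T) {m : ℕ} (hm : 1 ≤ m) (hmL : m ≤ lam.colLen 0) :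
    content lam mu T (lam.colLen 0 - m + 1) ≤ lam.rowLen 0 - mu.rowLen (m - 1) := by
  have hfirst : rowsContent lam mu T 1 m ≤ lam.rowLen 0 - mu.rowLen (m - 1) := by
    rw [← Nat.card_Ico]
    refine card_le_card_of_injOn Prod.snd ?_ ?_
    · rintro ⟨i, j⟩ hx
      rw [mem_coe, mem_filter] at hx
      have h1 := mem_skewDiagram_row.1 hx.1
      have h2 := snd_lt_rowLen_zero hx.1
      have h3 := hx.2.2
      simp only at h2 h3
      have h4 := mu.rowLen_anti i (m - 1) (by omega)
      simp only [coe_Ico, Set.mem_Ico]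
      omega
    · intro x hx y hy hxy
      rw [mem_coe, mem_filter] at hx hy
      exact h.eq_of_col hx.1 hy.1 (hx.2.1.trans hy.2.1.symm) hxy
  have hstep : ∀ t, rowsContent lam mu T (t + 1) (m + t) ≤ rowsContent lam mu T 1 m := by
    intro t
    induction t with
    | zero => exact le_rfl
    | succ t ih => exact (h.rowsContent_succ_le (Nat.le_add_left 1 t) (m + t)).trans ih
  have := (hstep (lam.colLen 0 - m)).trans hfirst
  rwa [rowsContent_eq_content (by omega)] at this

/-- A column contains at most k entries ≤ k, since they are distinct. `colFill` attains equality for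
every k. -/
theorem sum_content_le (h : IsLRFilling lam mu T) (k : ℕ) :
    ∑ v ∈ range k, content lam mu T (v + 1) ≤
      ∑ j ∈ range (lam.rowLen 0), min k (lam.colLen j - mu.colLen j) := by
  have h1 : ∑ v ∈ range k, content lam mu T (v + 1) =
      ((skewDiagram lam mu).filter fun x => T x.1 x.2 ≤ k).card := by
    rw [card_eq_sum_card_fiberwise (f := fun x => T x.1 x.2 - 1) (t := range k)]
    · refine sum_congr rfl fun v hv => ?_
      rw [mem_range] at hv
      rw [content, filter_filter]
      congr 1
      refine filter_congr ?_
      rintro ⟨i, j⟩ hx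
      have := h.pos i j hx
      simp only
      omega
    · rintro ⟨i, j⟩ hx
      rw [mem_coe, mem_filter] at hx
      have := h.pos i j hx.1
      have := hx.2
      simp only [coe_range, Set.mem_Iio]
      simp only at this
      omega
  rw [h1, card_eq_sum_card_fiberwise (f := Prod.snd) (t := range (lam.rowLen 0))]
  · refine sum_le_sum fun j _ => ?_
    rw [filter_filter, le_min_iff]
    constructor
    · refine (card_le_card_of_injOn (t := Icc 1 k) (fun x => T x.1 x.2) ?_ ?_).trans_eq (by simp)
      · rintro ⟨i, j⟩ hx
        rw [mem_coe, mem_filter] at hx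
        have := h.pos i j hx.1
        rw [mem_coe, mem_Icc]
        exact ⟨this, hx.2.1⟩
      · intro x hx y hy hxy
        rw [mem_coe, mem_filter] at hx hy
        exact h.eq_of_col hx.1 hy.1 hxy (hx.2.2.trans hy.2.2.symm)
    · rw [← Nat.card_Ico]
      refine card_le_card_of_injOn Prod.fst ?_ ?_
      · rintro ⟨i, j'⟩ hx
        rw [mem_coe, mem_filter] at hx
        have h2 := hx.2.2
        simp only at h2
        subst h2
        rw [mem_coe, mem_Ico]
        exact mem_skewDiagram_col.1 hx.1
      · intro x hx y hy hxy
        rw [mem_coe, mem_filter] at hx hy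
        exact Prod.ext hxy (hx.2.2.trans hy.2.2.symm)
  · intro x hx
    rw [mem_coe, mem_filter] at hx
    rw [mem_coe, mem_range]
    exact snd_lt_rowLen_zero hx.1

end IsLRFilling

/-! ### Explicit Littlewood–Richardson fillings -/

/-- A filling is lattice if boxes with equal entries have different keys and every entry `k + 1` is
preceded by an entry `k` with the same key. -/
theorem lattice_of_key {lam mu : YoungDiagram} {T : ℕ → ℕ → ℕ} (key : ℕ × ℕ → ℕ)
    (hinj : ∀ x ∈ skewDiagram lam mu, ∀ y ∈ skewDiagram lam mu, T x.1 x.2 = T y.1 y.2 →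
      key x = key y → x = y)
    (hprev : ∀ x ∈ skewDiagram lam mu, ∀ k, 1 ≤ k → T x.1 x.2 = k + 1 →
      ∃ y ∈ skewDiagram lam mu, T y.1 y.2 = k ∧ key y = key x ∧ y.1 < x.1)
    (i j k : ℕ) (hk : 1 ≤ k) :
    letterCount lam mu T (k + 1) i j ≤ letterCount lam mu T k i j := by
  classical
  let f : ℕ × ℕ → ℕ × ℕ := fun x =>
    if hx : x ∈ skewDiagram lam mu ∧ T x.1 x.2 = k + 1 then (hprev x hx.1 k hk hx.2).choose else x
  have hf : ∀ x, x ∈ skewDiagram lam mu → T x.1 x.2 = k + 1 →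
      f x ∈ skewDiagram lam mu ∧ T (f x).1 (f x).2 = k ∧ key (f x) = key x ∧ (f x).1 < x.1 := by
    intro x hx hT
    simp only [f, dif_pos (And.intro hx hT)]
    exact (hprev x hx k hk hT).choose_spec
  refine card_le_card_of_injOn f ?_ ?_
  · intro x hx
    rw [mem_coe, mem_filter] at hx ⊢
    obtain ⟨h1, h2, h3, h4⟩ := hf x hx.1 hx.2.1
    refine ⟨h1, h2, Or.inl ?_⟩
    rcases hx.2.2 with h | h <;> omega
  · intro x hx y hy hxy
    rw [mem_coe, mem_filter] at hx hy
    refine hinj x hx.1 y hy.1 (hx.2.1.trans hy.2.1.symm) ?_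
    rw [← (hf x hx.1 hx.2.1).2.2.1, ← (hf y hy.1 hy.2.1).2.2.1, hxy]

/-- The length of a column of a skew diagram. -/
def skewColLen (lam mu : YoungDiagram) (j : ℕ) : ℕ := lam.colLen j - mu.colLen j

/-- The filling of `lam / mu` whose columns are filled with `1, 2, 3, …`. -/
def colFill (lam mu : YoungDiagram) (i j : ℕ) : ℕ :=
  if (i, j) ∈ skewDiagram lam mu then i - mu.colLen j + 1 else 0

theorem colFill_of_mem {lam mu : YoungDiagram} {i j : ℕ} (h : (i, j) ∈ skewDiagram lam mu) :
    colFill lam mu i j = i - mu.colLen j + 1 := if_pos h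

theorem isLRFilling_colFill (lam mu : YoungDiagram) : IsLRFilling lam mu (colFill lam mu) where
  pos i j h := by rw [colFill_of_mem h]; omega
  zero i j h := if_neg h
  row_weak i j h h' := by
    have := mu.colLen_anti j (j + 1) (Nat.le_succ j)
    rw [colFill_of_mem h, colFill_of_mem h']
    omega
  col_strict i j h h' := by
    rw [colFill_of_mem h, colFill_of_mem h']
    rw [mem_skewDiagram_col] at h
    omega
  lattice := by
    refine lattice_of_key Prod.snd ?_ ?_
    · rintro ⟨i, j⟩ hx ⟨i', j'⟩ hy hT hj
      simp only at hT hj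
      subst hj
      rw [colFill_of_mem hx, colFill_of_mem hy] at hT
      rw [mem_skewDiagram_col] at hx hy
      rw [Prod.mk.injEq]
      omega
    · rintro ⟨i, j⟩ hx k hk hT
      simp only at hT
      rw [colFill_of_mem hx] at hT
      rw [mem_skewDiagram_col] at hx
      have hy : (i - 1, j) ∈ skewDiagram lam mu := by
        rw [mem_skewDiagram_col]
        omega
      refine ⟨(i - 1, j), hy, ?_, rfl, ?_⟩
      · simp only
        rw [colFill_of_mem hy]
        omega
      · simp only
        omega

theorem content_colFill (lam mu : YoungDiagram) {v : ℕ} (hv : 1 ≤ v) :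
    content lam mu (colFill lam mu) v =
      ((range (lam.rowLen 0)).filter fun j => v ≤ skewColLen lam mu j).card := by
  refine card_bij' (fun x _ => x.2) (fun j _ => (mu.colLen j + v - 1, j)) ?_ ?_ ?_ ?_
  · rintro ⟨i, j⟩ hx
    rw [mem_filter] at hx
    have h1 := snd_lt_rowLen_zero hx.1
    have h2 := hx.2
    simp only at h1 h2
    rw [colFill_of_mem hx.1] at h2
    have h3 := mem_skewDiagram_col.1 hx.1
    rw [mem_filter, mem_range, skewColLen]
    exact ⟨h1, by simp only; omega⟩
  · intro j hj
    rw [mem_filter, mem_range, skewColLen] at hj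
    have hmem : (mu.colLen j + v - 1, j) ∈ skewDiagram lam mu := by
      rw [mem_skewDiagram_col]
      omega
    rw [mem_filter]
    refine ⟨hmem, ?_⟩
    simp only
    rw [colFill_of_mem hmem]
    omega
  · rintro ⟨i, j⟩ hx
    rw [mem_filter] at hx
    have h2 := hx.2
    simp only at h2
    rw [colFill_of_mem hx.1] at h2
    have h3 := mem_skewDiagram_col.1 hx.1
    simp only [Prod.mk.injEq, and_true]
    omega
  · intro j _
    rfl

/-- The filling `colFill` with the bottom entry of the column `s` increased by one. -/
def bumpFill (lam mu : YoungDiagram) (s i j : ℕ) : ℕ :=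
  if i + 1 = lam.colLen s ∧ j = s then skewColLen lam mu s + 1 else colFill lam mu i j

section bump

variable {lam mu : YoungDiagram} {s s' : ℕ}

theorem bumpFill_of_not {i j : ℕ} (h : ¬ (i + 1 = lam.colLen s ∧ j = s)) :
    bumpFill lam mu s i j = colFill lam mu i j := if_neg h

theorem bumpFill_bottom {i : ℕ} (h : i + 1 = lam.colLen s) :
    bumpFill lam mu s i s = skewColLen lam mu s + 1 := if_pos ⟨h, rfl⟩

/-- The column s' has the same length as s but ends higher up, so its bottom entry precedes the new
entry in the reading and justifies it. By `hright`, either the bottom box of s has no right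
neighbour, or column s + 1 starts higher and the neighbour's entry is already large enough. -/
theorem isLRFilling_bumpFill (hpos : 1 ≤ skewColLen lam mu s)
    (hlen : skewColLen lam mu s' = skewColLen lam mu s)
    (hmu : mu.colLen s' < mu.colLen s)
    (hright : lam.colLen (s + 1) < lam.colLen s ∨ mu.colLen (s + 1) < mu.colLen s) :
    IsLRFilling lam mu (bumpFill lam mu s) where
  pos i j h := by
    by_cases hb : i + 1 = lam.colLen s ∧ j = s
    · obtain ⟨hb, rfl⟩ := hb
      rw [bumpFill_bottom hb]
      omega
    · rw [bumpFill_of_not hb]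
      exact (isLRFilling_colFill lam mu).pos i j h
  zero i j h := by
    by_cases hb : i + 1 = lam.colLen s ∧ j = s
    · obtain ⟨hb, rfl⟩ := hb
      rw [mem_skewDiagram_col] at h
      rw [skewColLen] at hpos
      omega
    · rw [bumpFill_of_not hb]
      exact (isLRFilling_colFill lam mu).zero i j h
  row_weak i j h h' := by
    have h1 := (isLRFilling_colFill lam mu).row_weak i j h h'
    by_cases hb : i + 1 = lam.colLen s ∧ j = s
    · obtain ⟨hb, rfl⟩ := hb
      rw [bumpFill_bottom hb, bumpFill_of_not (by omega), colFill_of_mem h', skewColLen]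
      rw [mem_skewDiagram_col] at h h'
      omega
    · rw [bumpFill_of_not hb]
      by_cases hb' : i + 1 = lam.colLen s ∧ j + 1 = s
      · obtain ⟨hb', rfl⟩ := hb'
        rw [bumpFill_bottom hb']
        rw [colFill_of_mem h'] at h1
        rw [mem_skewDiagram_col] at h h'
        rw [skewColLen]
        omega
      · rwa [bumpFill_of_not hb']
  col_strict i j h h' := by
    have h1 := (isLRFilling_colFill lam mu).col_strict i j h h'
    have hb : ¬ (i + 1 = lam.colLen s ∧ j = s) := by
      rintro ⟨hb, rfl⟩
      rw [mem_skewDiagram_col] at h'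
      omega
    rw [bumpFill_of_not hb]
    by_cases hb' : i + 1 + 1 = lam.colLen s ∧ j = s
    · obtain ⟨hb', rfl⟩ := hb'
      rw [bumpFill_bottom hb']
      rw [colFill_of_mem h'] at h1
      rw [mem_skewDiagram_col] at h h'
      rw [skewColLen]
      omega
    · rwa [bumpFill_of_not hb']
  lattice := by
    have hpos' := hpos
    have hlen' := hlen
    rw [skewColLen] at hpos'
    rw [skewColLen, skewColLen] at hlen'
    have hss : s' ≠ s := by rintro rfl; exact lt_irrefl _ hmu
    have hcol : ∀ i, (i, s') ∈ skewDiagram lam mu →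
        bumpFill lam mu s i s' ≠ skewColLen lam mu s + 1 := by
      intro i hi
      rw [bumpFill_of_not (by omega), colFill_of_mem hi, skewColLen]
      rw [mem_skewDiagram_col] at hi
      omega
    -- The key is the column, except that the raised box is regarded as a continuation of column s'.
    refine lattice_of_key (fun x => if x.1 + 1 = lam.colLen s ∧ x.2 = s then s' else x.2) ?_ ?_
    · rintro ⟨i, j⟩ hx ⟨i', j'⟩ hy hT hj
      simp only at hT hj
      by_cases hb : i + 1 = lam.colLen s ∧ j = s
      · by_cases hb' : i' + 1 = lam.colLen s ∧ j' = s
        · rw [Prod.mk.injEq]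
          omega
        · rw [if_pos hb, if_neg hb'] at hj
          subst hj
          obtain ⟨hb, rfl⟩ := hb
          rw [bumpFill_bottom hb] at hT
          exact absurd hT.symm (hcol i' hy)
      · by_cases hb' : i' + 1 = lam.colLen s ∧ j' = s
        · rw [if_neg hb, if_pos hb'] at hj
          subst hj
          obtain ⟨hb', rfl⟩ := hb'
          rw [bumpFill_bottom hb'] at hT
          exact absurd hT (hcol i hx)
        · rw [if_neg hb, if_neg hb'] at hj
          rw [bumpFill_of_not hb, bumpFill_of_not hb'] at hT
          exact (isLRFilling_colFill lam mu).eq_of_col hx hy hT hj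
    · rintro ⟨i, j⟩ hx k hk hT
      simp only at hT
      by_cases hb : i + 1 = lam.colLen s ∧ j = s
      · obtain ⟨hb, rfl⟩ := hb
        rw [bumpFill_bottom hb, skewColLen] at hT
        have hy : (lam.colLen s' - 1, s') ∈ skewDiagram lam mu := by
          rw [mem_skewDiagram_col]
          omega
        refine ⟨(lam.colLen s' - 1, s'), hy, ?_, ?_, ?_⟩
        · simp only
          rw [bumpFill_of_not (by omega), colFill_of_mem hy]
          omega
        · simp only
          rw [if_neg (by omega), if_pos ⟨hb, trivial⟩]
        · simp only
          omega
      · rw [bumpFill_of_not hb, colFill_of_mem hx] at hT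
        have hx' := mem_skewDiagram_col.1 hx
        have hy : (i - 1, j) ∈ skewDiagram lam mu := by
          rw [mem_skewDiagram_col]
          omega
        have hyb : ¬ (i - 1 + 1 = lam.colLen s ∧ j = s) := by
          rintro ⟨hyb, rfl⟩
          omega
        refine ⟨(i - 1, j), hy, ?_, ?_, ?_⟩
        · simp only
          rw [bumpFill_of_not hyb, colFill_of_mem hy]
          omega
        · simp only
          rw [if_neg hb, if_neg hyb]
        · simp only
          omega

theorem content_bumpFill_add_one (hpos : 1 ≤ skewColLen lam mu s) :
    content lam mu (bumpFill lam mu s) (skewColLen lam mu s) + 1 =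
      content lam mu (colFill lam mu) (skewColLen lam mu s) := by
  have hpos' := hpos
  rw [skewColLen] at hpos'
  have hmem : (lam.colLen s - 1, s) ∈ skewDiagram lam mu := by
    rw [mem_skewDiagram_col]
    omega
  rw [content, content, ← card_insert_of_notMem (a := (lam.colLen s - 1, s))]
  · congr 1
    ext ⟨i, j⟩
    rw [mem_insert, mem_filter, mem_filter, Prod.mk.injEq]
    by_cases hb : i + 1 = lam.colLen s ∧ j = s
    · obtain ⟨hb, rfl⟩ := hb
      obtain rfl : i = lam.colLen j - 1 := by omega
      simp only [hmem, true_and, and_self, true_or, true_iff]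
      rw [colFill_of_mem hmem, skewColLen]
      omega
    · rw [bumpFill_of_not hb]
      have : ¬ (i = lam.colLen s - 1 ∧ j = s) := by omega
      simp only [this, false_or]
  · rw [mem_filter]
    simp only
    rw [bumpFill_bottom (by omega)]
    omega

theorem content_bumpFill_succ (hpos : 1 ≤ skewColLen lam mu s) :
    content lam mu (bumpFill lam mu s) (skewColLen lam mu s + 1) =
      content lam mu (colFill lam mu) (skewColLen lam mu s + 1) + 1 := by
  have hpos' := hpos
  rw [skewColLen] at hpos'
  have hmem : (lam.colLen s - 1, s) ∈ skewDiagram lam mu := by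
    rw [mem_skewDiagram_col]
    omega
  rw [content, content, ← card_insert_of_notMem (a := (lam.colLen s - 1, s))]
  · congr 1
    ext ⟨i, j⟩
    rw [mem_insert, mem_filter, mem_filter, Prod.mk.injEq]
    by_cases hb : i + 1 = lam.colLen s ∧ j = s
    · obtain ⟨hb, rfl⟩ := hb
      obtain rfl : i = lam.colLen j - 1 := by omega
      simp only [hmem, true_and, and_self, true_or, iff_true]
      exact bumpFill_bottom hb
    · rw [bumpFill_of_not hb]
      have : ¬ (i = lam.colLen s - 1 ∧ j = s) := by omega
      simp only [this, false_or]
  · rw [mem_filter]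
    simp only
    rw [colFill_of_mem hmem, skewColLen]
    omega

end bump

/-- The length of a row of a skew diagram. -/
def skewRowLen (lam mu : YoungDiagram) (i : ℕ) : ℕ := lam.rowLen i - mu.rowLen i

/-- The number of rows among the first `i` ones that have more than `t` boxes. -/
def longRows (lam mu : YoungDiagram) (t i : ℕ) : ℕ :=
  ((range i).filter fun i' => t < skewRowLen lam mu i').card

theorem longRows_succ (lam mu : YoungDiagram) (t i : ℕ) :
    longRows lam mu t (i + 1) =
      longRows lam mu t i + if t < skewRowLen lam mu i then 1 else 0 := by
  rw [longRows, range_add_one, filter_insert]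
  split_ifs with h
  · rw [card_insert_of_notMem (by simp)]
    rfl
  · rfl

theorem longRows_mono (lam mu : YoungDiagram) {t t' i i' : ℕ} (ht : t' ≤ t) (hi : i ≤ i') :
    longRows lam mu t i ≤ longRows lam mu t' i' := by
  refine card_le_card fun x hx => ?_
  rw [mem_filter, mem_range] at hx ⊢
  exact ⟨hx.1.trans_le hi, ht.trans_lt hx.2⟩

/-- The filling of `lam / mu` in which, among the boxes at a fixed distance from the right ends of
the rows, the entries are `1, 2, 3, …` from top to bottom. -/
def rowFill (lam mu : YoungDiagram) (i j : ℕ) : ℕ :=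
  if (i, j) ∈ skewDiagram lam mu then longRows lam mu (lam.rowLen i - 1 - j) (i + 1) else 0

theorem rowFill_of_mem {lam mu : YoungDiagram} {i j : ℕ} (h : (i, j) ∈ skewDiagram lam mu) :
    rowFill lam mu i j = longRows lam mu (lam.rowLen i - 1 - j) i + 1 := by
  rw [rowFill, if_pos h, longRows_succ, if_pos]
  rw [mem_skewDiagram_row] at h
  rw [skewRowLen]
  omega

theorem exists_row_before {lam mu : YoungDiagram} {t i : ℕ} (h : 0 < longRows lam mu t i) :
    ∃ i' < i, t < skewRowLen lam mu i' ∧ longRows lam mu t i' + 1 = longRows lam mu t i := by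
  induction i with
  | zero => simp [longRows] at h
  | succ i ih =>
    rw [longRows_succ] at h ⊢
    by_cases hr : t < skewRowLen lam mu i
    · exact ⟨i, Nat.lt_succ_self i, hr, by rw [if_pos hr]⟩
    · rw [if_neg hr, add_zero] at h ⊢
      obtain ⟨i', h1, h2, h3⟩ := ih h
      exact ⟨i', by omega, h2, h3⟩

theorem rowFill_eq_of_key {lam mu : YoungDiagram} {x y : ℕ × ℕ} (hx : x ∈ skewDiagram lam mu)
    (hy : y ∈ skewDiagram lam mu) (hT : rowFill lam mu x.1 x.2 = rowFill lam mu y.1 y.2)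
    (hkey : lam.rowLen x.1 - 1 - x.2 = lam.rowLen y.1 - 1 - y.2) : x = y := by
  obtain ⟨i, j⟩ := x
  obtain ⟨i', j'⟩ := y
  simp only at hT hkey
  have h1 : longRows lam mu (lam.rowLen i - 1 - j) (i + 1) =
      longRows lam mu (lam.rowLen i - 1 - j) i + 1 := by
    rw [← rowFill_of_mem hx, rowFill, if_pos hx]
  have h2 : longRows lam mu (lam.rowLen i - 1 - j) (i' + 1) =
      longRows lam mu (lam.rowLen i - 1 - j) i' + 1 := by
    rw [hkey, ← rowFill_of_mem hy, rowFill, if_pos hy]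
  rw [rowFill_of_mem hx, rowFill_of_mem hy, ← hkey] at hT
  have hii : i = i' := by
    rcases lt_trichotomy i i' with hlt | heq | hlt
    · have := longRows_mono lam mu (le_refl (lam.rowLen i - 1 - j)) (show i + 1 ≤ i' from hlt)
      omega
    · exact heq
    · have := longRows_mono lam mu (le_refl (lam.rowLen i - 1 - j)) (show i' + 1 ≤ i from hlt)
      omega
  subst hii
  rw [mem_skewDiagram_row] at hx hy
  rw [Prod.mk.injEq]
  omega

/-- The distance from the right end of the row serves as key. Columns increase because a lower box
is no farther from the end of its row, and smaller distances are reached by at least as many rows.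
-/
theorem isLRFilling_rowFill (lam mu : YoungDiagram) : IsLRFilling lam mu (rowFill lam mu) where
  pos i j h := by rw [rowFill_of_mem h]; omega
  zero i j h := if_neg h
  row_weak i j h h' := by
    rw [rowFill_of_mem h, rowFill_of_mem h', add_le_add_iff_right]
    exact longRows_mono lam mu (by omega) le_rfl
  col_strict i j h h' := by
    rw [rowFill_of_mem h', rowFill, if_pos h, Nat.lt_succ_iff]
    have := lam.rowLen_anti i (i + 1) (Nat.le_succ i)
    exact longRows_mono lam mu (by omega) le_rfl
  lattice := by
    refine lattice_of_key (fun x => lam.rowLen x.1 - 1 - x.2)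
      (fun x hx y hy hT hkey => rowFill_eq_of_key hx hy hT hkey) ?_
    rintro ⟨i, j⟩ hx k hk hT
    simp only at hT ⊢
    rw [rowFill_of_mem hx] at hT
    obtain ⟨i', hi', hr, hl⟩ := exists_row_before (lam := lam) (mu := mu)
      (t := lam.rowLen i - 1 - j) (i := i) (by omega)
    rw [skewRowLen] at hr
    have hy : (i', lam.rowLen i' - 1 - (lam.rowLen i - 1 - j)) ∈ skewDiagram lam mu := by
      rw [mem_skewDiagram_row]
      omega
    have hkey : lam.rowLen i' - 1 - (lam.rowLen i' - 1 - (lam.rowLen i - 1 - j)) =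
        lam.rowLen i - 1 - j := by omega
    refine ⟨_, hy, ?_, hkey, hi'⟩
    simp only
    rw [rowFill_of_mem hy, hkey]
    omega

/-- At distance s or more from the right end all entries are below v, and at each of the s smaller
distances v occurs at most once. -/
theorem content_rowFill_le {lam mu : YoungDiagram} {s v : ℕ}
    (h : longRows lam mu s (lam.colLen 0) < v) : content lam mu (rowFill lam mu) v ≤ s := by
  rw [← card_range s]
  refine card_le_card_of_injOn (fun x => lam.rowLen x.1 - 1 - x.2) ?_ ?_
  · rintro ⟨i, j⟩ hx
    rw [mem_coe, mem_filter] at hx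
    have h1 := hx.2
    simp only at h1
    rw [rowFill, if_pos hx.1] at h1
    rw [mem_coe, mem_range]
    by_contra hcon
    push Not at hcon
    have := longRows_mono lam mu hcon (show i + 1 ≤ lam.colLen 0 from fst_lt_colLen_zero hx.1)
    simp only at this
    omega
  · intro x hx y hy hxy
    rw [mem_coe, mem_filter] at hx hy
    exact rowFill_eq_of_key hx.1 hy.1 (hx.2.trans hy.2.symm) hxy

theorem content_rowFill_colLen_pos {lam mu : YoungDiagram} (h0 : 0 < lam.colLen 0)
    (h : ∀ i < lam.colLen 0, mu.rowLen i < lam.rowLen i) :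
    0 < content lam mu (rowFill lam mu) (lam.colLen 0) := by
  have hlast := h (lam.colLen 0 - 1) (by omega)
  have hmem : (lam.colLen 0 - 1, lam.rowLen (lam.colLen 0 - 1) - 1) ∈ skewDiagram lam mu := by
    rw [mem_skewDiagram_row]
    omega
  refine card_pos.2 ⟨_, mem_filter.2 ⟨hmem, ?_⟩⟩
  rw [rowFill, if_pos hmem, longRows, filter_true_of_mem, card_range]
  · omega
  · intro i hi
    rw [mem_range] at hi
    have := h i (by omega)
    simp only [skewRowLen]
    omega

/-! ### Partitions with two different parts -/

theorem lt_rowLen_iff_lt_colLen (nu : YoungDiagram) (i j : ℕ) :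
    j < nu.rowLen i ↔ i < nu.colLen j := by
  rw [← YoungDiagram.mem_iff_lt_rowLen, YoungDiagram.mem_iff_lt_colLen]

theorem eq_ite_of_antitoneOn_of_two_values {f : ℕ → ℕ} {n r x y : ℕ}
    (hf : ∀ i j, i ≤ j → j < n → f j ≤ f i) (hxy : y < x)
    (hval : ∀ i < n, f i = x ∨ f i = y) (hr : ((range n).filter fun i => f i = y).card = r)
    (i : ℕ) (hi : i < n) : f i = if i < n - r then x else y := by
  have hsplit : ((range n).filter fun i => f i = x).card + r = n := by
    rw [← hr, ← card_union_of_disjoint]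
    · conv_rhs => rw [← card_range n]
      congr 1
      ext j
      rw [mem_union, mem_filter, mem_filter, ← and_or_left, and_iff_left_iff_imp]
      exact fun hj => hval j (mem_range.1 hj)
    · rw [disjoint_filter]
      intro j _ h1 h2
      omega
  split_ifs with h
  · refine (hval i hi).resolve_right fun hy => ?_
    have : ((range n).filter fun i => f i = x).card ≤ (range i).card := by
      refine card_le_card fun j hj => ?_
      rw [mem_filter, mem_range] at hj
      rw [mem_range]
      by_contra hcon
      have := hf i j (by omega) hj.1
      omega
    rw [card_range] at this
    omega
  · refine (hval i hi).resolve_left fun hx => ?_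
    have : (range (i + 1)).card ≤ ((range n).filter fun i => f i = x).card := by
      refine card_le_card fun j hj => ?_
      rw [mem_range] at hj
      rw [mem_filter, mem_range]
      have h1 := hf j i (by omega) hi
      refine ⟨by omega, ?_⟩
      rcases hval j (by omega) with h | h <;> omega
    rw [card_range] at this
    omega

/-- `lam / mu` is the rectangle of `L` rows of length `a` without the rectangle `(c^m)` at its upper
left corner and the rectangle `(e^q)` at its lower right corner. -/
structure IsTwoRect (lam mu : YoungDiagram) (a L m c q e : ℕ) : Prop where
  lam_row : ∀ i, lam.rowLen i = if i < L - q then a else if i < L then a - e else 0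
  mu_row : ∀ i, mu.rowLen i = if i < m then c else 0
  m_pos : 1 ≤ m
  c_pos : 1 ≤ c
  q_pos : 1 ≤ q
  e_pos : 1 ≤ e
  m_lt : m < L
  q_lt : q < L
  c_lt : c < a
  e_lt : e < a
  disj : c + e ≤ a ∨ m + q < L

namespace IsTwoRect

variable {lam mu : YoungDiagram} {a L m c q e : ℕ}

theorem lam_col (h : IsTwoRect lam mu a L m c q e) (j : ℕ) :
    lam.colLen j = if j < a - e then L else if j < a then L - q else 0 := by
  refine eq_of_forall_lt_iff fun i => ?_
  rw [← lt_rowLen_iff_lt_colLen, h.lam_row]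
  have := h.q_lt
  split_ifs <;> omega

theorem mu_col (h : IsTwoRect lam mu a L m c q e) (j : ℕ) :
    mu.colLen j = if j < c then m else 0 := by
  refine eq_of_forall_lt_iff fun i => ?_
  rw [← lt_rowLen_iff_lt_colLen, h.mu_row]
  split_ifs <;> omega

theorem colLen_zero (h : IsTwoRect lam mu a L m c q e) : lam.colLen 0 = L := by
  have := h.e_lt
  rw [h.lam_col, if_pos (by omega)]

theorem rowLen_zero (h : IsTwoRect lam mu a L m c q e) : lam.rowLen 0 = a := by
  have := h.q_lt
  rw [h.lam_row, if_pos (by omega)]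

theorem mu_colLen_zero (h : IsTwoRect lam mu a L m c q e) : mu.colLen 0 = m := by
  have := h.c_pos
  rw [h.mu_col, if_pos (by omega)]

theorem mem_skewDiagram (h : IsTwoRect lam mu a L m c q e) (i j : ℕ) :
    (i, j) ∈ skewDiagram lam mu ↔
      i < L ∧ j < a ∧ (i < m → c ≤ j) ∧ (L - q ≤ i → j < a - e) := by
  have := h.q_lt
  rw [mem_skewDiagram_row, h.lam_row, h.mu_row]
  split_ifs <;> omega

theorem skewDiagram_eq {al be : YoungDiagram} (h : IsTwoRect lam mu a L m c q e)
    (h' : IsTwoRect al be a L m c q e) : skewDiagram al be = skewDiagram lam mu := by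
  ext ⟨i, j⟩
  rw [h.mem_skewDiagram, h'.mem_skewDiagram]

theorem isRotation {al be : YoungDiagram} (h : IsTwoRect lam mu a L m c q e)
    (h' : IsTwoRect al be a L q e m c) :
    IsRotation (skewDiagram lam mu) (skewDiagram al be) := by
  have h1 := h.q_lt
  have h2 := h.m_lt
  have h3 := h.c_lt
  have h4 := h.e_lt
  refine ⟨L - 1, a - 1, fun i j => ?_⟩
  rw [h'.mem_skewDiagram]
  constructor
  · rintro ⟨hi, hj, h5, h6⟩
    refine ⟨(L - 1 - i, a - 1 - j), (h.mem_skewDiagram _ _).2 ⟨?_, ?_, ?_, ?_⟩, ?_, ?_⟩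
    · omega
    · omega
    · intro hlt
      have := h6 (by omega)
      omega
    · intro hle
      have := h5 (by omega)
      omega
    · simp only
      omega
    · simp only
      omega
  · rintro ⟨⟨x, y⟩, hx, h5, h6⟩
    obtain ⟨h7, h8, h9, h10⟩ := (h.mem_skewDiagram x y).1 hx
    simp only at h5 h6
    refine ⟨by omega, by omega, fun hi => ?_, fun hi => ?_⟩
    · have := h10 (by omega)
      omega
    · have := h9 (by omega)
      omega

theorem dp_eq_two (h : IsTwoRect lam mu a L m c q e) : dp lam = 2 := by
  have h1 := h.q_lt
  have h2 := h.q_pos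
  have h3 := h.e_pos
  have h4 := h.e_lt
  have : lam.rowLens.toFinset = {a, a - e} := by
    ext x
    rw [YoungDiagram.rowLens, List.mem_toFinset, List.mem_map, mem_insert, mem_singleton,
      h.colLen_zero]
    constructor
    · rintro ⟨i, hi, rfl⟩
      rw [List.mem_range] at hi
      rw [h.lam_row]
      split_ifs <;> simp
    · rintro (rfl | rfl)
      · exact ⟨0, List.mem_range.2 (by omega), by rw [h.lam_row, if_pos (by omega)]⟩
      · exact ⟨L - 1, List.mem_range.2 (by omega), by
          rw [h.lam_row, if_neg (by omega), if_pos (by omega)]⟩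
  rw [dp, this, card_pair (by omega)]

end IsTwoRect

theorem IsRectangle.exists_row {mu : YoungDiagram} (h : IsRectangle mu) :
    mu = ⊥ ∨ ∃ m c, 1 ≤ m ∧ 1 ≤ c ∧ ∀ i, mu.rowLen i = if i < m then c else 0 := by
  obtain ⟨m, c, hmc⟩ := h
  by_cases h0 : m = 0 ∨ c = 0
  · left
    ext x
    rw [hmc]
    rcases h0 with rfl | rfl <;> simp
  · right
    push Not at h0
    refine ⟨m, c, by omega, by omega, fun i => ?_⟩
    refine eq_of_forall_lt_iff fun j => ?_
    rw [← YoungDiagram.mem_iff_lt_rowLen, ← YoungDiagram.mem_cells, hmc, mem_product, mem_range,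
      mem_range]
    split_ifs with hi <;> simp [hi]

theorem exists_isTwoRect {lam mu : YoungDiagram} (hb : IsBasic lam mu) (hmu : IsRectangle mu)
    (hne : mu ≠ ⊥) (hdp : dp lam = 2) : ∃ a L m c q e, IsTwoRect lam mu a L m c q e := by
  obtain ⟨m, c, hm, hc, hrow⟩ := hmu.exists_row.resolve_left hne
  have hmem : ∀ x, x ∈ lam.rowLens.toFinset ↔ ∃ i < lam.colLen 0, lam.rowLen i = x := by
    intro x
    simp [YoungDiagram.rowLens]
  obtain ⟨x, y, hyx, hset⟩ : ∃ x y, y < x ∧ lam.rowLens.toFinset = {x, y} := by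
    obtain ⟨x, y, hxy, hset⟩ := card_eq_two.1 hdp
    rcases lt_or_gt_of_ne hxy with h | h
    · exact ⟨y, x, h, by rw [hset, pair_comm]⟩
    · exact ⟨x, y, h, hset⟩
  have hval : ∀ i < lam.colLen 0, lam.rowLen i = x ∨ lam.rowLen i = y := by
    intro i hi
    have := (hmem _).2 ⟨i, hi, rfl⟩
    rw [hset] at this
    simpa using this
  obtain ⟨ix, hix, hx⟩ := (hmem x).1 (by rw [hset]; simp)
  obtain ⟨iy, hiy, hy⟩ := (hmem y).1 (by rw [hset]; simp)
  obtain ⟨q, hq⟩ : ∃ q, ((range (lam.colLen 0)).filter fun i => lam.rowLen i = y).card = q :=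
    ⟨_, rfl⟩
  have hlam := eq_ite_of_antitoneOn_of_two_values (f := lam.rowLen)
    (fun i j hij _ => lam.rowLen_anti i j hij) hyx hval hq
  have hqL : q < lam.colLen 0 := by
    by_contra hcon
    have := hlam ix hix
    rw [if_neg (by omega)] at this
    omega
  have hq1 : 1 ≤ q := by
    by_contra hcon
    have := hlam iy hiy
    rw [if_pos (by omega)] at this
    omega
  have hy1 : 0 < y := by
    rw [← hy, lt_rowLen_iff_lt_colLen]
    exact hiy
  have hlam' : ∀ i, lam.rowLen i =
      if i < lam.colLen 0 - q then x else if i < lam.colLen 0 then x - (x - y) else 0 := by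
    intro i
    by_cases hi : i < lam.colLen 0
    · rw [hlam i hi]
      split_ifs <;> omega
    · rw [rowLen_eq_zero (by omega), if_neg (by omega), if_neg hi]
  have hmL : m - 1 < lam.colLen 0 := by
    have h1 : (m - 1, 0) ∈ mu := by
      rw [YoungDiagram.mem_iff_lt_rowLen, hrow, if_pos (by omega)]
      omega
    have h2 : (m - 1, 0) ∈ lam := hb.1 h1
    rwa [YoungDiagram.mem_iff_lt_colLen] at h2
  -- Basicness at the last row of mu: row m of lam has at least c boxes. This gives `m < L` and the
  -- alternative `disj`, according to whether row m is long or short.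
  obtain ⟨h1, h2⟩ := hb.2 (m - 1) hmL
  rw [hrow, if_pos (by omega), hlam'] at h1
  rw [hrow, if_pos (by omega), hlam'] at h2
  refine ⟨x, lam.colLen 0, m, c, q, x - y, hlam', hrow, hm, hc, hq1, by omega, ?_, hqL, ?_,
    by omega, ?_⟩
  · split_ifs at h2 <;> omega
  · split_ifs at h1 <;> omega
  · split_ifs at h2 <;> omega

/-! ### Reconstructing the column lengths -/

theorem eq_ite_of_antitoneOn_of_card_upper {f : ℕ → ℕ} {n t x y : ℕ}
    (hf : ∀ i j, i ≤ j → j < n → f j ≤ f i) (hxy : y < x)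
    (hval : ∀ i < n, f i = x ∨ f i = y) (ht : ((range n).filter fun i => f i = x).card = t)
    (i : ℕ) (hi : i < n) : f i = if i < t then x else y := by
  have hsplit : t + ((range n).filter fun i => f i = y).card = n := by
    rw [← ht, ← card_union_of_disjoint]
    · conv_rhs => rw [← card_range n]
      congr 1
      ext j
      rw [mem_union, mem_filter, mem_filter, ← and_or_left, and_iff_left_iff_imp]
      exact fun hj => hval j (mem_range.1 hj)
    · rw [disjoint_filter]
      intro j _ h1 h2
      omega
  rw [eq_ite_of_antitoneOn_of_two_values hf hxy hval rfl i hi]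
  congr 2
  omega

section core

variable {f g : ℕ → ℕ} {a L m q c e d : ℕ}

/-- The case of three column lengths `L - m`, `L` and `L - q`. -/
theorem columns_of_full (hf : ∀ i j, i ≤ j → j < a → f j ≤ f i)
    (hfL : ∀ j, f j ≤ L) (hg : ∀ j < d, g j + m = f j) (hg' : ∀ j, d ≤ j → g j = f j)
    (hd : d < a) (hd0 : 0 < d) (hf0 : f 0 = L) (hm : 1 ≤ m) (hq : 1 ≤ q) (hmL : m < L)
    (hqL : q < L) (hmq : m ≠ q) (hval : ∀ j < a, g j = L - m ∨ g j = L ∨ g j = L - q)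
    (hcm : ((range a).filter fun j => g j = L - m).card = c)
    (hcq : ((range a).filter fun j => g j = L - q).card = e)
    (hE : ∀ j < d, ∀ j', d ≤ j' → j' < a → g j = g j' → g j ≠ L - m ∧ g j ≠ L - q) :
    d = c ∧ ∀ j < a, f j = if j < a - e then L else L - q := by
  have hg0 := hg 0 hd0
  have h1 : ∀ j < d, g j = L - m := by
    intro j hj
    by_contra hne
    have hgj := hg j hj
    have hfj := hfL j
    have hjq : g j = L - q := by
      rcases hval j (by omega) with h | h | h <;> omega
    -- If a column j < d had length L - q, column d could share its length neither with column 0 nor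
    -- with column j, so it would be full. Monotonicity of f then forces m = q.
    have h2 : g d = L := by
      rcases hval d hd with h | h | h
      · exact absurd (by omega) (hE 0 hd0 d le_rfl hd (by omega)).1
      · exact h
      · exact absurd hjq (hE j hj d le_rfl hd (by omega)).2
    have h3 := hf j d hj.le hd
    have h4 := hg' d le_rfl
    omega
  have h2 : ∀ j, d ≤ j → j < a → g j ≠ L - m := by
    intro j hj hja h
    exact (hE 0 hd0 j hj hja (by rw [h1 0 hd0, h])).1 (h1 0 hd0)
  have hdc : ((range a).filter fun j => g j = L - m) = range d := by
    ext j
    rw [mem_filter, mem_range, mem_range]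
    constructor
    · rintro ⟨hj, hgj⟩
      by_contra hcon
      exact h2 j (by omega) hj hgj
    · intro hj
      exact ⟨by omega, h1 j hj⟩
  rw [hdc, card_range] at hcm
  refine ⟨hcm, ?_⟩
  refine eq_ite_of_antitoneOn_of_two_values hf (by omega) ?_ ?_
  · intro j hj
    rcases lt_or_ge j d with h | h
    · have := h1 j h
      have := hg j h
      left
      omega
    · rw [← hg' j h]
      exact (hval j hj).resolve_left (h2 j h hj)
  · rw [← hcq]
    congr 1
    refine filter_congr fun j hj => ?_
    rw [mem_range] at hj
    rcases lt_or_ge j d with h | h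
    · have := h1 j h
      have := hg j h
      omega
    · rw [hg' j h]

/-- The case of three column lengths `L - m`, `L - m - q` and `L - q`. -/
theorem columns_of_overlap (hf : ∀ i j, i ≤ j → j < a → f j ≤ f i)
    (hg : ∀ j < d, g j + m = f j) (hg' : ∀ j, d ≤ j → g j = f j)
    (hd : d < a) (hd0 : 0 < d) (hf0 : f 0 = L) (hm : 1 ≤ m) (hq : 1 ≤ q) (hmqL : m + q < L)
    (hmq : m ≠ q) (hval : ∀ j < a, g j = L - m ∨ g j = L - m - q ∨ g j = L - q)
    (hc : c < a)
    (hcm : ((range a).filter fun j => g j = L - m).card = a - e)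
    (hcq : ((range a).filter fun j => g j = L - q).card = a - c)
    (hlast : f (a - 1) = L - q)
    (hE : ∀ j < d, ∀ j', d ≤ j' → j' < a → g j = g j' → g j ≠ L - m ∧ g j ≠ L - q) :
    d = c ∧ ∀ j < a, f j = if j < a - e then L else L - q := by
  have hg0 := hg 0 hd0
  have hge : ∀ j < a, L - q ≤ f j := fun j hj => by
    rw [← hlast]
    exact hf j (a - 1) (by omega) (by omega)
  -- Column 0 already uses the length L - m, and L - m - q is shorter than the last column.
  have h2 : ∀ j, d ≤ j → j < a → g j = L - q := by
    intro j hj hja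
    rcases hval j hja with h | h | h
    · exact absurd (by omega) (hE 0 hd0 j hj hja (by omega)).1
    · have := hge j hja
      have := hg' j hj
      omega
    · exact h
  have h1 : ∀ j < d, g j = L - m ∨ g j = L - m - q := by
    intro j hj
    rcases hval j (by omega) with h | h | h
    · exact Or.inl h
    · exact Or.inr h
    · exact absurd h (hE j hj d le_rfl hd (by rw [h, h2 d le_rfl hd])).2
  have hdc : ((range a).filter fun j => g j = L - q) = Ico d a := by
    ext j
    rw [mem_filter, mem_range, mem_Ico]
    constructor
    · rintro ⟨hj, hgj⟩
      refine ⟨?_, hj⟩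
      by_contra hcon
      rcases h1 j (by omega) with h | h <;> omega
    · rintro ⟨hj, hja⟩
      exact ⟨hja, h2 j hj hja⟩
  rw [hdc, Nat.card_Ico] at hcq
  refine ⟨by omega, ?_⟩
  refine eq_ite_of_antitoneOn_of_card_upper hf (by omega) ?_ ?_
  · intro j hj
    rcases lt_or_ge j d with h | h
    · have := hg j h
      rcases h1 j h with h' | h' <;> omega
    · right
      rw [← hg' j h, h2 j h hj]
  · rw [← hcm]
    congr 1
    refine filter_congr fun j hj => ?_
    rw [mem_range] at hj
    rcases lt_or_ge j d with h | h
    · have := hg j h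
      omega
    · have := hg' j h
      have := h2 j h hj
      omega

/-- The case of two column lengths `L - m` and `L`. -/
theorem columns_of_full_of_eq (hf : ∀ i j, i ≤ j → j < a → f j ≤ f i)
    (hfL : ∀ j, f j ≤ L) (hg : ∀ j < d, g j + m = f j) (hg' : ∀ j, d ≤ j → g j = f j)
    (hd : d < a) (hm : 1 ≤ m) (hmL : m < L) (hce : c + e ≤ a)
    (hval : ∀ j < a, g j = L - m ∨ g j = L)
    (hcL : ((range a).filter fun j => g j = L).card = a - (c + e)) :
    d ≤ c + e ∧ ∀ j < a, f j = if j < a - (c + e - d) then L else L - m := by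
  have h1 : ∀ j < d, g j = L - m := by
    intro j hj
    have := hg j hj
    have := hfL j
    rcases hval j (by omega) with h | h <;> omega
  -- The full columns of the outer partition are the d columns meeting the inner one and the full
  -- columns of the skew diagram.
  have hcard : ((range a).filter fun j => f j = L).card = d + (a - (c + e)) := by
    rw [← hcL, ← card_range d, ← card_union_of_disjoint]
    · congr 1
      ext j
      rw [mem_union, mem_filter, mem_filter, mem_range, mem_range]
      rcases lt_or_ge j d with h | h
      · have := hg j h
        have := h1 j h
        omega
      · have := hg' j h
        omega
    · rw [disjoint_left]
      intro j hj hj'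
      rw [mem_range] at hj
      rw [mem_filter] at hj'
      have := h1 j hj
      omega
  have hle : ((range a).filter fun j => f j = L).card ≤ a :=
    (card_filter_le _ _).trans_eq (card_range a)
  refine ⟨by omega, fun j hj => ?_⟩
  rw [eq_ite_of_antitoneOn_of_card_upper hf (y := L - m) (by omega) ?_ hcard j hj]
  · congr 2
    omega
  · intro j hj
    rcases lt_or_ge j d with h | h
    · have := hg j h
      have := h1 j h
      omega
    · have := hg' j h
      have := hval j hj
      omega

/-- The case of two column lengths `L - m` and `L - m - m`. -/
theorem columns_of_overlap_of_eq (hf : ∀ i j, i ≤ j → j < a → f j ≤ f i)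
    (hg : ∀ j < d, g j + m = f j) (hg' : ∀ j, d ≤ j → g j = f j)
    (hd : d < a) (hm : 1 ≤ m) (hmL : m + m < L) (hce : a < c + e) (hca : c < a) (hea : e < a)
    (hval : ∀ j < a, g j = L - m ∨ g j = L - m - m)
    (hcm : ((range a).filter fun j => g j = L - m).card = a - e + (a - c))
    (hlast : f (a - 1) = L - m) :
    d ≤ c + e ∧ ∀ j < a, f j = if j < a - (c + e - d) then L else L - m := by
  have h2 : ∀ j, d ≤ j → j < a → g j = L - m := by
    intro j hj hja
    have := hf j (a - 1) (by omega) (by omega)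
    have := hg' j hj
    rcases hval j hja with h | h <;> omega
  have hcard : ((range a).filter fun j => f j = L).card + (a - d) = a - e + (a - c) := by
    rw [← hcm, ← Nat.card_Ico, ← card_union_of_disjoint]
    · congr 1
      ext j
      rw [mem_union, mem_filter, mem_filter, mem_Ico, mem_range]
      rcases lt_or_ge j d with h | h
      · have := hg j h
        have := hval j (by omega)
        omega
      · have := h2 j h
        have := hg' j h
        omega
    · rw [disjoint_left]
      intro j hj hj'
      rw [mem_Ico] at hj'
      rw [mem_filter] at hj
      have := h2 j hj'.1 hj'.2
      have := hg' j hj'.1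
      omega
  refine ⟨by omega, fun j hj => ?_⟩
  rw [eq_ite_of_antitoneOn_of_card_upper hf (x := L) (y := L - m) (by omega) ?_ rfl j hj]
  · congr 2
    omega
  · intro j hj
    rcases lt_or_ge j d with h | h
    · have := hg j h
      have := hval j hj
      omega
    · have := hg' j h
      have := h2 j h hj
      omega

end core

/-! ### Comparing the contents of two diagrams -/

/-- Every content of a Littlewood–Richardson filling of `lam / mu` occurs for `al / be`. -/
def ContentsSubset (lam mu al be : YoungDiagram) : Prop :=
  ∀ T, IsLRFilling lam mu T → ∃ T', IsLRFilling al be T' ∧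
    ∀ v, 1 ≤ v → content al be T' v = content lam mu T v

theorem IsBasic.skewColLen_pos {lam mu : YoungDiagram} (h : IsBasic lam mu) {j : ℕ}
    (hj : j < lam.rowLen 0) : 1 ≤ skewColLen lam mu j := by
  have hlt : mu.colLen j < lam.colLen j := by
    rcases Nat.eq_zero_or_pos (mu.colLen j) with h0 | h0
    · rw [h0, ← lt_rowLen_iff_lt_colLen]
      exact hj
    · have h1 : j < mu.rowLen (mu.colLen j - 1) := by
        rw [lt_rowLen_iff_lt_colLen]
        omega
      have h2 : (mu.colLen j - 1, j) ∈ lam := h.1 (YoungDiagram.mem_iff_lt_rowLen.2 h1)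
      have h3 := YoungDiagram.mem_iff_lt_colLen.1 h2
      have h4 := (h.2 (mu.colLen j - 1)
        (h3.trans_le (lam.colLen_anti _ _ (Nat.zero_le _)))).2
      rw [Nat.sub_add_cancel h0] at h4
      rw [← lt_rowLen_iff_lt_colLen]
      omega
  rw [skewColLen]
  omega

section compare

variable {lam mu al be : YoungDiagram}

/-- A basic diagram has no empty columns, so `colFill` has one entry 1 in each column, while no
filling of lam / mu has more than `lam.rowLen 0` of them. -/
theorem ContentsSubset.rowLen_zero_le (h : ContentsSubset al be lam mu) (hb : IsBasic al be) :
    al.rowLen 0 ≤ lam.rowLen 0 := by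
  obtain ⟨T, hT, hc⟩ := h _ (isLRFilling_colFill al be)
  have h1 := hT.content_le_rowLen 0
  rw [hc 1 le_rfl, content_colFill al be le_rfl, filter_true_of_mem, card_range] at h1
  · exact h1
  · intro j hj
    exact hb.skewColLen_pos (mem_range.1 hj)

/-- In a diagram without empty rows, `rowFill` uses the number of rows as an entry, and by
`entry_le` no entry exceeds the number of rows. -/
theorem ContentsSubset.colLen_zero_le (h : ContentsSubset al be lam mu) (hb : IsBasic al be) :
    al.colLen 0 ≤ lam.colLen 0 := by
  rcases Nat.eq_zero_or_pos (al.colLen 0) with h0 | h0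
  · omega
  obtain ⟨T, hT, hc⟩ := h _ (isLRFilling_rowFill al be)
  have h1 := content_rowFill_colLen_pos h0 fun i hi => (hb.2 i hi).1
  rw [← hc _ h0] at h1
  obtain ⟨⟨i, j⟩, hx⟩ := card_pos.1 h1
  rw [mem_filter] at hx
  have h2 := hT.entry_le hx.1
  have h3 := fst_lt_colLen_zero hx.1
  have h4 := hx.2
  simp only at h3 h4
  omega

/-- The number of columns with at least `v` boxes. -/
def longCols (lam mu : YoungDiagram) (v : ℕ) : ℕ :=
  ((range (lam.rowLen 0)).filter fun j => v ≤ skewColLen lam mu j).card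

theorem sum_min_skewColLen (lam mu : YoungDiagram) (k : ℕ) :
    ∑ j ∈ range (lam.rowLen 0), min k (lam.colLen j - mu.colLen j) =
      ∑ v ∈ range k, longCols lam mu (v + 1) := by
  simp_rw [longCols, card_filter]
  rw [sum_comm]
  refine sum_congr rfl fun j _ => ?_
  rw [← card_filter, ← card_range (min k _)]
  congr 1
  ext v
  rw [mem_filter, mem_range, mem_range, skewColLen]
  omega

theorem ContentsSubset.sum_longCols_le (h : ContentsSubset al be lam mu) (k : ℕ) :
    ∑ v ∈ range k, longCols al be (v + 1) ≤ ∑ v ∈ range k, longCols lam mu (v + 1) := by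
  obtain ⟨T, hT, hc⟩ := h _ (isLRFilling_colFill al be)
  rw [← sum_min_skewColLen lam mu]
  refine le_trans (le_of_eq ?_) (hT.sum_content_le k)
  refine sum_congr rfl fun v _ => ?_
  rw [hc _ (Nat.le_add_left 1 v), content_colFill _ _ (Nat.le_add_left 1 v), longCols]

/-- Both sides are contents of `colFill`, and each of these dominates the other by `sum_content_le`.
-/
theorem ContentsSubset.longCols_eq (h : ContentsSubset al be lam mu)
    (h' : ContentsSubset lam mu al be) {v : ℕ} (hv : 1 ≤ v) :
    longCols al be v = longCols lam mu v := by
  obtain ⟨k, rfl⟩ := Nat.exists_eq_add_of_le' hv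
  have h1 := le_antisymm (h.sum_longCols_le k) (h'.sum_longCols_le k)
  have h2 := le_antisymm (h.sum_longCols_le (k + 1)) (h'.sum_longCols_le (k + 1))
  rw [sum_range_succ, sum_range_succ, h1] at h2
  omega

theorem longCols_eq_add (lam mu : YoungDiagram) (v : ℕ) :
    longCols lam mu v =
      ((range (lam.rowLen 0)).filter fun j => skewColLen lam mu j = v).card +
        longCols lam mu (v + 1) := by
  rw [longCols, longCols, ← card_union_of_disjoint]
  · congr 1
    ext j
    rw [mem_union, mem_filter, mem_filter, mem_filter, ← and_or_left]
    exact and_congr_right fun _ => by omega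
  · rw [disjoint_filter]
    intro j _ h1 h2
    omega

theorem ContentsSubset.card_cols_eq (h : ContentsSubset al be lam mu)
    (h' : ContentsSubset lam mu al be) {v : ℕ} (hv : 1 ≤ v) :
    ((range (al.rowLen 0)).filter fun j => skewColLen al be j = v).card =
      ((range (lam.rowLen 0)).filter fun j => skewColLen lam mu j = v).card := by
  have h1 := h.longCols_eq h' hv
  have h2 := h.longCols_eq h' (show 1 ≤ v + 1 by omega)
  rw [longCols_eq_add al be, longCols_eq_add lam mu, h2] at h1
  omega

/-- Transfer of `rowFill`: few long rows in al / be make its content small at v + 1, and this bounds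
the rows of lam below mu. -/
theorem ContentsSubset.rowLen_add_le (h : ContentsSubset al be lam mu) {s v : ℕ}
    (hs : longRows al be s (al.colLen 0) ≤ v) : lam.rowLen (mu.colLen 0 + v) ≤ s := by
  obtain ⟨T, hT, hc⟩ := h _ (isLRFilling_rowFill al be)
  refine (hT.rowLen_add_le_content v).trans ?_
  rw [hc _ (Nat.le_add_left 1 v)]
  exact content_rowFill_le (Nat.lt_succ_of_le hs)

theorem ContentsSubset.rowLen_sub_le (h : ContentsSubset al be lam mu) {s v : ℕ}
    (hs : longRows al be s (al.colLen 0) ≤ v) : lam.rowLen v - mu.rowLen 0 ≤ s := by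
  obtain ⟨T, hT, hc⟩ := h _ (isLRFilling_rowFill al be)
  refine (hT.rowLen_sub_le_content v).trans ?_
  rw [hc _ (Nat.le_add_left 1 v)]
  exact content_rowFill_le (Nat.lt_succ_of_le hs)

/-- Columns below and beside be start at different heights, so equal lengths on both sides allow
`bumpFill`, whose content is transferred to lam / mu. -/
theorem ContentsSubset.exists_bump (h : ContentsSubset al be lam mu)
    (h' : ContentsSubset lam mu al be) (hb : IsBasic al be) {k d : ℕ} (hk : 1 ≤ k)
    (hbe : ∀ j, be.colLen j = if j < d then k else 0) {j j' : ℕ} (hj : j < d) (hj' : d ≤ j')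
    (hja : j' < al.rowLen 0) {v : ℕ} (hjv : skewColLen al be j = v)
    (hjv' : skewColLen al be j' = v) :
    ∃ T, IsLRFilling lam mu T ∧ content lam mu T v + 1 = longCols lam mu v ∧
      content lam mu T (v + 1) = longCols lam mu (v + 1) + 1 := by
  -- The rightmost column of length v below be is raised: its right neighbour is either beside be or
  -- a strictly shorter column of al.
  obtain ⟨s, hs, hmax⟩ := ((range d).filter fun x => skewColLen al be x = v).exists_max_image id
    ⟨j, mem_filter.2 ⟨mem_range.2 hj, hjv⟩⟩
  rw [mem_filter, mem_range] at hs
  have hpos : 1 ≤ v := by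
    rw [← hjv']
    exact hb.skewColLen_pos hja
  have hfill : IsLRFilling al be (bumpFill al be s) := by
    refine isLRFilling_bumpFill (s' := j') (by omega) (by omega) ?_ ?_
    · rw [hbe, hbe, if_neg (by omega), if_pos hs.1]
      omega
    · by_cases hsd : s + 1 < d
      · left
        refine lt_of_le_of_ne (al.colLen_anti _ _ (Nat.le_succ s)) fun heq => ?_
        have h1 : skewColLen al be (s + 1) = v := by
          rw [← hs.2, skewColLen, skewColLen, heq, hbe, hbe, if_pos hsd, if_pos hs.1]
        have h2 := hmax (s + 1) (mem_filter.2 ⟨mem_range.2 hsd, h1⟩)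
        simp only [id] at h2
        omega
      · right
        rw [hbe, hbe, if_neg hsd, if_pos hs.1]
        omega
  obtain ⟨T, hT, hc⟩ := h _ hfill
  have h1 := content_bumpFill_add_one (lam := al) (mu := be) (s := s) (by omega)
  have h2 := content_bumpFill_succ (lam := al) (mu := be) (s := s) (by omega)
  rw [hs.2] at h1 h2
  refine ⟨T, hT, ?_, ?_⟩
  · rw [hc v hpos, h1, content_colFill _ _ hpos, ← h.longCols_eq h' hpos, longCols]
  · rw [hc _ (by omega), h2, content_colFill _ _ (by omega), ← h.longCols_eq h' (by omega),
      longCols]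

end compare

/-! ### Consequences for a rectangle without two corners -/

namespace IsTwoRect

variable {lam mu al be : YoungDiagram} {a L m c q e : ℕ}

theorem skewColLen_eq (h : IsTwoRect lam mu a L m c q e) {j : ℕ} (hj : j < a) :
    skewColLen lam mu j =
      (if j < a - e then L else L - q) - (if j < c then m else 0) := by
  rw [skewColLen, h.lam_col, h.mu_col, if_pos hj]

/-- Rows meeting a removed corner have at most a - c or a - e boxes, so only the rows strictly
between the corners can be longer than s. -/
theorem longRows_le (h : IsTwoRect lam mu a L m c q e) {s : ℕ} (hc : a ≤ s + c)
    (he : a ≤ s + e) : longRows lam mu s (lam.colLen 0) ≤ L - q - m := by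
  rw [longRows, ← Nat.card_Ico]
  refine card_le_card fun i hi => ?_
  rw [mem_filter, skewRowLen, h.lam_row, h.mu_row] at hi
  rw [mem_Ico]
  split_ifs at hi <;> omega

theorem longCols_m_lt_q (h : IsTwoRect lam mu a L m c q e) (hmq : m < q) :
    longCols lam mu (L - m) = a - e ∧ longCols lam mu (L - q + 1) = a - e := by
  have h1 := h.q_lt
  have h2 := h.disj
  have h3 := h.m_pos
  rw [longCols, longCols, h.rowLen_zero]
  constructor
  · rw [← card_range (a - e)]
    congr 1
    ext j
    rw [mem_filter, mem_range, mem_range]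
    by_cases hj : j < a
    · rw [h.skewColLen_eq hj]
      split_ifs <;> omega
    · omega
  · rw [← card_range (a - e)]
    congr 1
    ext j
    rw [mem_filter, mem_range, mem_range]
    by_cases hj : j < a
    · rw [h.skewColLen_eq hj]
      split_ifs <;> omega
    · omega

theorem longCols_q_lt_m (h : IsTwoRect lam mu a L m c q e) (hmq : q < m) :
    longCols lam mu (L - m + 1) = a - c ∧ longCols lam mu (L - q) = a - c := by
  have h1 := h.m_lt
  have h2 := h.disj
  have h3 := h.q_pos
  rw [longCols, longCols, h.rowLen_zero]
  constructor
  · rw [← Nat.card_Ico c a]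
    congr 1
    ext j
    rw [mem_filter, mem_range, mem_Ico]
    by_cases hj : j < a
    · rw [h.skewColLen_eq hj]
      split_ifs <;> omega
    · omega
  · rw [← Nat.card_Ico c a]
    congr 1
    ext j
    rw [mem_filter, mem_range, mem_Ico]
    by_cases hj : j < a
    · rw [h.skewColLen_eq hj]
      split_ifs <;> omega
    · omega

/-- Columns of length `L - m` or `L - q` cannot occur both below and beside `be`. -/
theorem length_ne_of_eq (h : IsTwoRect lam mu a L m c q e) (hmq : m ≠ q)
    (hBA : ContentsSubset al be lam mu) (hAB : ContentsSubset lam mu al be) (hb : IsBasic al be)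
    {k d : ℕ} (hk : 1 ≤ k) (hbe : ∀ j, be.colLen j = if j < d then k else 0) {j j' : ℕ}
    (hj : j < d) (hj' : d ≤ j') (hja : j' < al.rowLen 0)
    (heq : skewColLen al be j = skewColLen al be j') :
    skewColLen al be j ≠ L - m ∧ skewColLen al be j ≠ L - q := by
  have h1 := h.m_lt
  have h2 := h.q_lt
  have h3 := h.e_lt
  have h4 := h.c_lt
  have hm := h.m_pos
  have hq := h.q_pos
  constructor
  · intro hv
    obtain ⟨T, hT, hc1, hc2⟩ := hBA.exists_bump hAB hb hk hbe hj hj' hja hv (heq ▸ hv)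
    -- For m < q the last row of lam requires at least a - e entries L - m, but one of the a - e is
    -- lost; for q < m at most a - c entries L - m + 1 are allowed, but one is gained.
    rcases lt_or_gt_of_ne hmq with hlt | hlt
    · have h5 := (h.longCols_m_lt_q hlt).1
      have h6 := hT.rowLen_add_le_content (L - m - 1)
      rw [h.mu_colLen_zero, h.lam_row, if_neg (by omega), if_pos (by omega),
        show L - m - 1 + 1 = L - m by omega] at h6
      omega
    · have h5 := (h.longCols_q_lt_m hlt).1
      have h6 := hT.content_le_sub hm (by rw [h.colLen_zero]; omega)
      rw [h.colLen_zero, h.rowLen_zero, h.mu_row, if_pos (by omega)] at h6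
      omega
  · intro hv
    obtain ⟨T, hT, hc1, hc2⟩ := hBA.exists_bump hAB hb hk hbe hj hj' hja hv (heq ▸ hv)
    -- For m < q the letter L - q + 1 would exceed its maximum a - e; for q < m the letter L - q
    -- would fall below its minimum a - c.
    rcases lt_or_gt_of_ne hmq with hlt | hlt
    · have h5 := (h.longCols_m_lt_q hlt).2
      have h6 := hT.content_le_rowLen (L - q)
      rw [h.lam_row, if_neg (by omega), if_pos (by omega)] at h6
      omega
    · have h5 := (h.longCols_q_lt_m hlt).2
      have h6 := hT.rowLen_sub_le_content (L - q - 1)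
      rw [h.lam_row, if_pos (by omega), h.mu_row, if_pos (by omega),
        show L - q - 1 + 1 = L - q by omega] at h6
      omega

theorem of_cols (ha : al.rowLen 0 = a) (hmu : ∀ i, be.rowLen i = if i < m then c else 0)
    (hcol : ∀ j < a, al.colLen j = if j < a - e then L else L - q)
    (hm : 1 ≤ m) (hc : 1 ≤ c) (hq : 1 ≤ q) (he : 1 ≤ e) (hmL : m < L) (hqL : q < L)
    (hca : c < a) (hea : e < a) (hd : c + e ≤ a ∨ m + q < L) : IsTwoRect al be a L m c q e := by
  refine ⟨fun i => ?_, hmu, hm, hc, hq, he, hmL, hqL, hca, hea, hd⟩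
  refine eq_of_forall_lt_iff fun j => ?_
  by_cases hj : j < a
  · rw [lt_rowLen_iff_lt_colLen, hcol j hj]
    split_ifs <;> omega
  · have : al.rowLen i ≤ a := ha ▸ al.rowLen_anti 0 i (Nat.zero_le i)
    split_ifs <;> omega

/-- At most L - m - m rows of al / be have more than a - min d d' boxes. Transferring `rowFill`, the
letter L - m occurs at most a - min d d' times, whereas fillings of lam / mu use it at least a - e
and at least a - c times. -/
theorem min_le (h : IsTwoRect lam mu a L m c m e) {d d' : ℕ}
    (h' : IsTwoRect al be a L m d m d') (hBA : ContentsSubset al be lam mu) :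
    min d d' ≤ min c e := by
  have h1 := h.m_lt
  have h2 := h.m_pos
  have h3 := h.c_lt
  have h4 := h.e_lt
  have h5 := h'.c_lt
  have hle := h'.longRows_le (s := a - min d d') (by omega) (by omega)
  have h6 := hBA.rowLen_add_le (v := L - m - 1) (hle.trans (by omega))
  have h7 := hBA.rowLen_sub_le (v := L - m - 1) (hle.trans (by omega))
  rw [h.mu_colLen_zero, h.lam_row, if_neg (by omega), if_pos (by omega)] at h6
  rw [h.lam_row, if_pos (by omega), h.mu_row, if_pos (by omega)] at h7
  omega

end IsTwoRect

/-! ### Column counts and identification of the second diagram -/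

namespace IsTwoRect

variable {lam mu al be : YoungDiagram} {a L m c q e : ℕ}

theorem card_cols_of_le (h : IsTwoRect lam mu a L m c q e) (hce : c + e ≤ a) (hmq : m ≠ q) :
    ((range a).filter fun j => skewColLen lam mu j = L - m).card = c ∧
      ((range a).filter fun j => skewColLen lam mu j = L - q).card = e := by
  have h1 := h.m_lt
  have h2 := h.q_lt
  have h3 := h.m_pos
  have h4 := h.q_pos
  have h5 := h.e_lt
  constructor
  · conv_rhs => rw [← card_range c]
    congr 1
    ext j
    rw [mem_filter, mem_range, mem_range]
    by_cases hj : j < a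
    · rw [h.skewColLen_eq hj]
      split_ifs <;> omega
    · omega
  · trans (Ico (a - e) a).card
    · congr 1
      ext j
      rw [mem_filter, mem_range, mem_Ico]
      by_cases hj : j < a
      · rw [h.skewColLen_eq hj]
        split_ifs <;> omega
      · omega
    · rw [Nat.card_Ico]
      omega

theorem card_cols_of_lt (h : IsTwoRect lam mu a L m c q e) (hce : a < c + e) (hmq : m ≠ q) :
    ((range a).filter fun j => skewColLen lam mu j = L - m).card = a - e ∧
      ((range a).filter fun j => skewColLen lam mu j = L - q).card = a - c := by
  have h1 := h.disj
  have h3 := h.m_pos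
  have h4 := h.q_pos
  have h5 := h.c_lt
  constructor
  · conv_rhs => rw [← card_range (a - e)]
    congr 1
    ext j
    rw [mem_filter, mem_range, mem_range]
    by_cases hj : j < a
    · rw [h.skewColLen_eq hj]
      split_ifs <;> omega
    · omega
  · rw [← Nat.card_Ico c a]
    congr 1
    ext j
    rw [mem_filter, mem_range, mem_Ico]
    by_cases hj : j < a
    · rw [h.skewColLen_eq hj]
      split_ifs <;> omega
    · omega

theorem card_full_cols (h : IsTwoRect lam mu a L m c m e) (hce : c + e ≤ a) :
    ((range a).filter fun j => skewColLen lam mu j = L).card = a - (c + e) := by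
  have h1 := h.m_lt
  have h3 := h.m_pos
  trans (Ico c (a - e)).card
  · congr 1
    ext j
    rw [mem_filter, mem_range, mem_Ico]
    by_cases hj : j < a
    · rw [h.skewColLen_eq hj]
      split_ifs <;> omega
    · omega
  · rw [Nat.card_Ico]
    omega

theorem card_long_cols (h : IsTwoRect lam mu a L m c m e) (hce : a < c + e) :
    ((range a).filter fun j => skewColLen lam mu j = L - m).card = a - e + (a - c) := by
  have h1 := h.disj
  have h3 := h.m_pos
  rw [← Nat.card_Ico c a, ← card_range (a - e), ← card_union_of_disjoint]
  · congr 1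
    ext j
    rw [mem_filter, mem_union, mem_range, mem_range, mem_Ico]
    by_cases hj : j < a
    · rw [h.skewColLen_eq hj]
      split_ifs <;> omega
    · omega
  · rw [disjoint_left]
    intro j hj hj'
    rw [mem_range] at hj
    rw [mem_Ico] at hj'
    omega

/-- A diagram with the same contents as a rectangle without two corner rectangles, and with
rectangular inner partition, has the same corner rectangles, possibly interchanged. -/
theorem isTwoRect_or (h : IsTwoRect lam mu a L m c q e) (hbA : IsBasic lam mu)
    (hb : IsBasic al be) (hbe : IsRectangle be) (hAB : ContentsSubset lam mu al be)
    (hBA : ContentsSubset al be lam mu) :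
    IsTwoRect al be a L m c q e ∨ IsTwoRect al be a L q e m c := by
  have ham := h.m_lt
  have haq := h.q_lt
  have hac := h.c_lt
  have hae := h.e_lt
  have hm := h.m_pos
  have hq := h.q_pos
  have hc := h.c_pos
  have he := h.e_pos
  have hdisj := h.disj
  have hala : al.rowLen 0 = a := by
    rw [← h.rowLen_zero]
    exact le_antisymm (hBA.rowLen_zero_le hb) (hAB.rowLen_zero_le hbA)
  have halL : al.colLen 0 = L := by
    rw [← h.colLen_zero]
    exact le_antisymm (hBA.colLen_zero_le hb) (hAB.colLen_zero_le hbA)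
  have hcard : ∀ v, 1 ≤ v → ((range a).filter fun j => skewColLen al be j = v).card =
      ((range a).filter fun j => skewColLen lam mu j = v).card := by
    intro v hv
    have := hBA.card_cols_eq hAB hv
    rwa [hala, h.rowLen_zero] at this
  have hval : ∀ j < a, ∃ j' < a, skewColLen al be j =
      (if j' < a - e then L else L - q) - (if j' < c then m else 0) := by
    intro j hj
    have h1 := hcard _ (hb.skewColLen_pos (hala.symm ▸ hj))
    have h2 : 0 < ((range a).filter fun j' => skewColLen al be j' = skewColLen al be j).card :=
      card_pos.2 ⟨j, mem_filter.2 ⟨mem_range.2 hj, rfl⟩⟩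
    rw [h1, card_pos] at h2
    obtain ⟨j', hj'⟩ := h2
    rw [mem_filter, mem_range] at hj'
    exact ⟨j', hj'.1, by rw [← hj'.2, h.skewColLen_eq hj'.1]⟩
  have hf : ∀ i j, i ≤ j → j < a → al.colLen j ≤ al.colLen i :=
    fun i j hij _ => al.colLen_anti i j hij
  have hfL : ∀ j, al.colLen j ≤ L := fun j => halL ▸ al.colLen_anti 0 j (Nat.zero_le j)
  have hrowA := h.longRows_le (s := a - 1) (by omega) (by omega)
  have hlastB : ∀ i, al.colLen (a - 1) ≤ i → al.rowLen i ≤ a - 1 := by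
    intro i hi
    by_contra hcon
    have : a - 1 < al.rowLen i := by omega
    rw [lt_rowLen_iff_lt_colLen] at this
    omega
  have hlastB' : ∀ i, al.rowLen i ≤ a - 1 → al.colLen (a - 1) ≤ i := by
    intro i hi
    by_contra hcon
    have : i < al.colLen (a - 1) := by omega
    rw [← lt_rowLen_iff_lt_colLen] at this
    omega
  rcases hbe.exists_row with hbot | ⟨k, d, hk, hd, hbrow⟩
  · -- a straight shape has only one content
    exfalso
    have hbcol : ∀ j, be.colLen j = 0 := by
      intro j
      by_contra hne
      have h0 : (0, j) ∈ be := YoungDiagram.mem_iff_lt_colLen.2 (Nat.pos_of_ne_zero hne)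
      rw [hbot] at h0
      exact YoungDiagram.notMem_bot _ h0
    have hg : ∀ j, skewColLen al be j = al.colLen j := by
      intro j
      rw [skewColLen, hbcol, Nat.sub_zero]
    -- By `rowFill`, the last column of al has at most L - q - m boxes. But column 0 has length L,
    -- which must be a column length of lam / mu; then c + e < a and all columns of lam / mu are
    -- longer than L - q - m.
    have h1 := hlastB' _ (by
      have := hAB.rowLen_add_le hrowA
      rwa [hbcol, zero_add] at this)
    obtain ⟨j', hj', hv⟩ := hval 0 (by omega)
    obtain ⟨j'', hj'', hv'⟩ := hval (a - 1) (by omega)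
    rw [hg] at hv hv'
    rw [halL] at hv
    split_ifs at hv hv' <;> omega
  have hbcol : ∀ j, be.colLen j = if j < d then k else 0 := by
    intro j
    refine eq_of_forall_lt_iff fun i => ?_
    rw [← lt_rowLen_iff_lt_colLen, hbrow]
    split_ifs <;> omega
  have hbcol0 : be.colLen 0 = k := by rw [hbcol, if_pos (by omega)]
  have hkL : k < L := by
    have h1 : (k - 1, 0) ∈ al := hb.1 (by
      rw [YoungDiagram.mem_iff_lt_rowLen, hbrow, if_pos (by omega)]
      omega)
    have h2 := (hb.2 (k - 1) (YoungDiagram.mem_iff_lt_colLen.1 h1)).2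
    rw [hbrow, if_pos (by omega), Nat.sub_add_cancel hk] at h2
    have h3 : 0 < al.rowLen k := by omega
    rw [lt_rowLen_iff_lt_colLen, halL] at h3
    exact h3
  have hda : d < a := by
    have h1 := (hb.2 0 (by omega)).1
    rw [hbrow, if_pos (by omega), hala] at h1
    exact h1
  have hg : ∀ j < d, skewColLen al be j + k = al.colLen j := by
    intro j hj
    have := hb.skewColLen_pos (j := j) (by omega)
    rw [skewColLen, hbcol, if_pos hj] at this ⊢
    omega
  have hg' : ∀ j, d ≤ j → skewColLen al be j = al.colLen j := by
    intro j hj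
    rw [skewColLen, hbcol, if_neg (by omega), Nat.sub_zero]
  have hg0 := hg 0 (by omega)
  -- Comparing `rowFill` in both directions shows that both diagrams have L - m - q rows with a
  -- boxes; in al / be these are the rows from k to the end of the last column.
  have hlast : m + q < L → al.colLen (a - 1) + (m + q) = L + k := by
    intro hmq
    refine le_antisymm ?_ ?_
    · have h1 := hlastB' _ (by
        have := hAB.rowLen_add_le hrowA
        rwa [hbcol0] at this)
      omega
    · by_contra hcon
      have h1 : longRows al be (a - 1) (al.colLen 0) ≤ al.colLen (a - 1) - k := by
        rw [longRows, ← Nat.card_Ico k]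
        refine card_le_card fun i hi => ?_
        rw [mem_filter, mem_range, skewRowLen, hbrow] at hi
        rw [mem_Ico]
        have h2 : a - 1 < al.rowLen i := by omega
        rw [lt_rowLen_iff_lt_colLen] at h2
        refine ⟨?_, h2⟩
        by_contra hik
        rw [if_pos (by omega)] at hi
        have := hala ▸ al.rowLen_anti 0 i (Nat.zero_le i)
        omega
      have h3 := hBA.rowLen_add_le (v := L - m - q - 1) (h1.trans (by omega))
      rw [h.mu_colLen_zero, h.lam_row, if_pos (by omega)] at h3
      omega
  by_cases hmq : m = q
  · subst hmq
    -- Column 0 of al / be has length L - k. In the overlapping case k = m + m must be excluded: by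
    -- `hlast` the last column would have L boxes, a length not present in lam / mu.
    have hkm : k = m := by
      obtain ⟨j', hj', hv⟩ := hval 0 (by omega)
      rcases hdisj with hce | hlt
      · split_ifs at hv <;> omega
      · have h1 := hlast hlt
        have h2 := hfL (a - 1)
        split_ifs at hv
        · omega
        · omega
        · have h3 := hf d (a - 1) (by omega) (by omega)
          have h4 := hg' (a - 1) (by omega)
          obtain ⟨j'', hj'', hv'⟩ := hval (a - 1) (by omega)
          split_ifs at hv' <;> omega
        · omega
    subst hkm
    have hcols : d ≤ c + e ∧
        ∀ j < a, al.colLen j = if j < a - (c + e - d) then L else L - k := by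
      by_cases hce : c + e ≤ a
      · refine columns_of_full_of_eq hf hfL hg hg' hda hk ham hce ?_ ?_
        · intro j hj
          obtain ⟨j', hj', hv⟩ := hval j hj
          split_ifs at hv <;> omega
        · rw [hcard L (by omega)]
          exact h.card_full_cols hce
      · refine columns_of_overlap_of_eq hf hg hg' hda hk (by omega) (by omega) hac hae ?_ ?_ ?_
        · intro j hj
          obtain ⟨j', hj', hv⟩ := hval j hj
          split_ifs at hv <;> omega
        · rw [hcard (L - k) (by omega)]
          exact h.card_long_cols (by omega)
        · have := hlast (by omega)
          omega
    obtain ⟨hdce, hcols⟩ := hcols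
    -- Otherwise the last column of al would be full, contrary to the bound that `rowFill` of lam /
    -- mu gives for row L - 1 of al.
    have hd0 : 1 ≤ c + e - d := by
      by_contra hcon
      have h1 := hcols (a - 1) (by omega)
      rw [if_pos (by omega)] at h1
      have h2 := hlastB' (L - 1) (by
        have := hAB.rowLen_add_le (v := L - k - 1) (hrowA.trans (by omega))
        rwa [hbcol0, show k + (L - k - 1) = L - 1 by omega] at this)
      omega
    have hda' : c + e - d < a := by
      by_contra hcon
      have := hcols 0 (by omega)
      rw [if_neg (by omega)] at this
      omega
    have hT : IsTwoRect al be a L k d k (c + e - d) :=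
      of_cols hala hbrow hcols hk hd hk hd0 ham ham hda hda' (by omega)
    have h1 := h.min_le hT hBA
    have h2 := hT.min_le h hAB
    -- The pairs (d, c + e - d) and (c, e) have the same sum and the same minimum.
    have h3 : d = c ∨ d = e := by omega
    rcases h3 with rfl | rfl
    · left
      rwa [Nat.add_sub_cancel_left] at hT
    · right
      rwa [Nat.add_sub_cancel] at hT
  · have hE : ∀ j < d, ∀ j', d ≤ j' → j' < a → skewColLen al be j = skewColLen al be j' →
        skewColLen al be j ≠ L - m ∧ skewColLen al be j ≠ L - q :=
      fun j hj j' hj' hja heq =>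
        h.length_ne_of_eq hmq hBA hAB hb hk hbcol hj hj' (hala.symm ▸ hja) heq
    have hE' : ∀ j < d, ∀ j', d ≤ j' → j' < a → skewColLen al be j = skewColLen al be j' →
        skewColLen al be j ≠ L - q ∧ skewColLen al be j ≠ L - m :=
      fun j hj j' hj' hja heq => (hE j hj j' hj' hja heq).symm
    by_cases hce : c + e ≤ a
    · obtain ⟨hcm, hcq⟩ := h.card_cols_of_le hce hmq
      rw [← hcard _ (by omega)] at hcm hcq
      have hval' : ∀ j < a, skewColLen al be j = L - m ∨ skewColLen al be j = L ∨
          skewColLen al be j = L - q := by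
        intro j hj
        obtain ⟨j', hj', hv⟩ := hval j hj
        split_ifs at hv <;> omega
      have hkmq : k = m ∨ k = q := by
        rcases hval' 0 (by omega) with hv | hv | hv <;> omega
      rcases hkmq with rfl | rfl
      · left
        obtain ⟨rfl, hcols⟩ := columns_of_full hf hfL hg hg' hda (by omega) halL hm hq ham haq
          hmq hval' hcm hcq hE
        exact of_cols hala hbrow hcols hm hc hq he ham haq hac hae hdisj
      · right
        obtain ⟨rfl, hcols⟩ := columns_of_full hf hfL hg hg' hda (by omega) halL hq hm haq ham
          (Ne.symm hmq) (fun j hj => by have := hval' j hj; tauto) hcq hcm hE'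
        exact of_cols hala hbrow hcols hq he hm hc haq ham hae hac (by omega)
    · have hmqL : m + q < L := by omega
      have hl := hlast hmqL
      obtain ⟨hcm, hcq⟩ := h.card_cols_of_lt (by omega) hmq
      rw [← hcard _ (by omega)] at hcm hcq
      have hval' : ∀ j < a, skewColLen al be j = L - m ∨ skewColLen al be j = L - m - q ∨
          skewColLen al be j = L - q := by
        intro j hj
        obtain ⟨j', hj', hv⟩ := hval j hj
        split_ifs at hv <;> omega
      -- By `hlast` the last column has length L + k - m - q; it must be one of the three lengths,
      -- and k ≥ 1 excludes L - m - q.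
      have hkmq : k = m ∨ k = q := by
        have h1 := hval' (a - 1) (by omega)
        rw [hg' _ (by omega)] at h1
        omega
      rcases hkmq with rfl | rfl
      · left
        obtain ⟨rfl, hcols⟩ := columns_of_overlap hf hg hg' hda (by omega) halL hm hq hmqL
          hmq hval' hac hcm hcq (by omega) hE
        exact of_cols hala hbrow hcols hm hc hq he ham haq hac hae hdisj
      · right
        obtain ⟨rfl, hcols⟩ := columns_of_overlap hf hg hg' hda (by omega) halL hq hm (by omega)
          (Ne.symm hmq) (fun j hj => by have := hval' j hj; omega) hae hcq hcm (by omega) hE'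
        exact of_cols hala hbrow hcols hq he hm hc haq ham hae hac (by omega)

end IsTwoRect

end SkewChar

/-! ### Conclusion for skew characters -/

theorem theorem3p5 (n : ℕ) (lam mu al be : YoungDiagram)
    (hlam : SkewChar.IsBasic lam mu) (hal : SkewChar.IsBasic al be)
    (hmu : SkewChar.IsRectangle mu) (hmu_ne : mu ≠ ⊥) (hbe : SkewChar.IsRectangle be)
    (hn : (SkewChar.skewDiagram lam mu).card = n) (hn' : (SkewChar.skewDiagram al be).card = n)
    (hchar : SkewChar.skewChar n lam mu = SkewChar.skewChar n al be)
    (hdp : SkewChar.dp lam = 2) :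
    SkewChar.dp al = 2 ∧
      (SkewChar.skewDiagram al be = SkewChar.skewDiagram lam mu ∨
        SkewChar.IsRotation (SkewChar.skewDiagram lam mu) (SkewChar.skewDiagram al be)) := by
  obtain ⟨a, L, m, c, q, e, h⟩ := SkewChar.exists_isTwoRect hlam hmu hmu_ne hdp
  rcases h.isTwoRect_or hlam hal hbe
      (fun _ hT => SkewChar.exists_filling_of_skewChar_eq hn hchar hT)
      (fun _ hT => SkewChar.exists_filling_of_skewChar_eq hn' hchar.symm hT) with h' | h'
  · exact ⟨h'.dp_eq_two, Or.inl (h.skewDiagram_eq h')⟩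
  · exact ⟨h'.dp_eq_two, Or.inr (h.isRotation h')⟩
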